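/- Let $\Omega\subset\mathbf R^2$ be a bounded domain (open, connected, nonempty) with Lipschitz boundary. Let $N\ge 1$, $\infty\ge\alpha_0>\alpha_1>\dots>\alpha_N>0$, $0<\beta_1<\dots<\beta_N<\infty$, $p>1$ and $\varepsilon>0$. Let $\mu_+,\mu_-$ be probability measures with compact support in $\Omega$, which in the case $\alpha_0=\infty$ are additionally finite linear combinations of Dirac masses. Let $\rho:\mathbf R^2\to[0,\infty)$ be smooth with support in the closed unit disk and $\int_{\mathbf R^2}\rho\,dx=1$; put $\rho_\varepsilon=\varepsilon^{-2}\rho(\cdot/\varepsilon)$ and $\mu_\pm^\varepsilon=\rho_\varepsilon*\mu_\pm$. Assume that $\mu_+^\varepsilon=\mu_-^\varepsilon$ on $\mathbf R^2\setminus\overline\Omega$ (this holds in particular if $\varepsilon$ is so small that $\mu_\pm^\varepsilon$ are supported in $\overline\Omega$). Let $X_\varepsilon^{\mu_+,\mu_-}$ be the set of all $(\sigma,\varphi_1,\dots,\varphi_N)\in L^2(\Omega;\mathbf R^2)\times W^{1,2}(\Omega)^N$ such that $\varphi_1=\dots=\varphi_N=1$ on $\partial\Omega$ (that is, $\varphi_i-1\in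 W^{1,2}_0(\Omega)$) and $\operatorname{div}\sigma=\mu_+^\varepsilon-\mu_-^\varepsilon$ in the sense that $$\int_{\mathbf R^2}\psi\,(\mu_+^\varepsilon-\mu_-^\varepsilon)\,dx=-\int_\Omega\nabla\psi\cdot\sigma\,dx\qquad\text{for all }\psi\in C^1_c(\mathbf R^2).$$ For $(\sigma,\varphi_1,\dots,\varphi_N)\in X_\varepsilon^{\mu_+,\mu_-}$ let $\gamma_\varepsilon(x)=\min_{1\le i\le N}\{\varphi_i(x)^2+\alpha_i^2\varepsilon^2/\beta_i\}$ and $$\mathcal E_\varepsilon^{\mu_+,\mu_-}[\sigma,\varphi_1,\dots,\varphi_N]=\int_\Omega\omega_\varepsilon\Big(\alpha_0,\frac{\gamma_\varepsilon(x)}\varepsilon,|\sigma(x)|\Big)dx+\sum_{i=1}^N\frac{\beta_i}2\int_\Omega\Big[\varepsilon|\nabla\varphi_i|^2+\frac{(\varphi_i-1)^2}\varepsilon\Big]dx\in[0,\infty],$$ where $\omega_\varepsilon(\infty,g,s)=\tfrac12 g s^2$ and, for $\alpha_0<\infty$, $\omega_\varepsilon(\alpha_0,g,s)=\tfrac12 g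 s^2+\varepsilon^p s^2$ if $s\le\alpha_0/g$ and $\omega_\varepsilon(\alpha_0,g,s)=\alpha_0\big(s-\tfrac{\alpha_0}{2g}\big)+\varepsilon^p s^2$ if $s>\alpha_0/g$. Then $\mathcal E_\varepsilon^{\mu_+,\mu_-}$ has a minimizer in $X_\varepsilon^{\mu_+,\mu_-}$, with finite minimal value: there is $(\sigma,\varphi_1,\dots,\varphi_N)\in X_\varepsilon^{\mu_+,\mu_-}$ with $\mathcal E_\varepsilon^{\mu_+,\mu_-}[\sigma,\varphi_1,\dots,\varphi_N]<\infty$ and $\mathcal E_\varepsilon^{\mu_+,\mu_-}[\sigma,\varphi_1,\dots,\varphi_N]\le\mathcal E_\varepsilon^{\mu_+,\mu_-}[\sigma',\varphi_1',\dots,\varphi_N']$ for all $(\sigma',\varphi_1',\dots,\varphi_N')\in X_\varepsilon^{\mu_+,\mu_-}$. -/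

import Mathlib

open MeasureTheory Filter Topology
open scoped ENNReal NNReal ContDiff

noncomputable section

namespace PhaseField

/-- The Euclidean plane `ℝ²`. -/
abbrev Plane : Type := EuclideanSpace ℝ (Fin 2)

/-- `Ω` has Lipschitz boundary: near each boundary point, in suitable Cartesian coordinates,
`Ω` is the region strictly below the graph of a Lipschitz function. -/
def HasLipschitzBoundary (Ω : Set Plane) : Prop :=
  ∀ x₀ ∈ frontier Ω, ∃ (T : Plane ≃ₗᵢ[ℝ] Plane) (K : ℝ≥0) (h : ℝ → ℝ) (r : ℝ),
    LipschitzWith K h ∧ 0 < r ∧ ∀ x ∈ Metric.ball x₀ r, x ∈ Ω ↔ T x 1 < h (T x 0)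

/-- The space `L²(Ω; F)`. -/
abbrev L2 (Ω : Set Plane) (F : Type) [NormedAddCommGroup F] : Type :=
  Lp F 2 ((volume : Measure Plane).restrict Ω)

/-- `ψ ∈ C_c^∞(Ω)`. -/
def IsTestFunction (Ω : Set Plane) (ψ : Plane → ℝ) : Prop :=
  ContDiff ℝ ∞ ψ ∧ HasCompactSupport ψ ∧ tsupport ψ ⊆ Ω

/-- `g` is the weak (distributional) gradient of `u` on `Ω`. -/
def HasWeakGradient (Ω : Set Plane) (u : L2 Ω ℝ) (g : L2 Ω Plane) : Prop :=
  ∀ ψ : Plane → ℝ, IsTestFunction Ω ψ →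
    ∫ x in Ω, u x • gradient ψ x = -∫ x in Ω, ψ x • g x

/-- On an open set the weak gradient is unique. -/
theorem HasWeakGradient.unique {Ω : Set Plane} (hΩ : IsOpen Ω) {u : L2 Ω ℝ} {g g' : L2 Ω Plane}
    (h : HasWeakGradient Ω u g) (h' : HasWeakGradient Ω u g') : g = g' := by
  have hloc : ∀ k : L2 Ω Plane, LocallyIntegrableOn k Ω := by
    intro k
    rw [locallyIntegrableOn_iff hΩ.isLocallyClosed]
    intro K hK hKc
    have hk : MemLp k 2 ((volume : Measure Plane).restrict K) :=
      (Lp.memLp k).mono_measure (Measure.restrict_mono hK le_rfl)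
    have : IsFiniteMeasure ((volume : Measure Plane).restrict K) :=
      ⟨by simpa using hKc.measure_lt_top⟩
    exact hk.integrable (by norm_num)
  have hint : ∀ (k : L2 Ω Plane) (ψ : Plane → ℝ), IsTestFunction Ω ψ →
      IntegrableOn (fun x => ψ x • k x) Ω := by
    intro k ψ hψ
    have hψ2 : MemLp ψ 2 ((volume : Measure Plane).restrict Ω) :=
      (hψ.1.continuous.memLp_of_hasCompactSupport hψ.2.1).restrict Ω
    have := (Lp.memLp k).smul (p := 2) (q := 2) (r := 1) hψ2
    exact memLp_one_iff_integrable.1 this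
  have key := hΩ.ae_eq_zero_of_integral_contDiff_smul_eq_zero (μ := volume)
    (f := fun x => g x - g' x) ((hloc g).sub (hloc g')) (by
      intro ψ hψ hc hs
      have hT : IsTestFunction Ω ψ := ⟨hψ, hc, hs⟩
      have e : ∫ x in Ω, ψ x • g x = ∫ x in Ω, ψ x • g' x :=
        neg_injective ((h ψ hT).symm.trans (h' ψ hT))
      rw [← setIntegral_eq_integral_of_forall_compl_eq_zero (s := Ω)
        (fun x hx => by
          rw [image_eq_zero_of_notMem_tsupport (fun hx' => hx (hs hx')), zero_smul])]
      simp only [smul_sub]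
      rw [integral_sub (hint g ψ hT) (hint g' ψ hT), e, sub_self])
  refine Lp.ext ?_
  rw [Filter.EventuallyEq, ae_restrict_iff' hΩ.measurableSet]
  filter_upwards [key] with x hx hxΩ using sub_eq_zero.1 (hx hxΩ)

/-- The Sobolev space `W^{1,2}(Ω)`: a function in `L²(Ω)` together with its weak gradient, which
is required to lie in `L²(Ω; ℝ²)` (and is determined by the function if `Ω` is open). -/
structure W12 (Ω : Set Plane) where
  val : L2 Ω ℝ
  grad : L2 Ω Plane
  isWeakGradient : HasWeakGradient Ω val grad

/-- `u = 1` on `∂Ω`, that is, `u - 1` belongs to `W₀^{1,2}(Ω)`, the closure of `C_c^∞(Ω)` in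
the norm of `W^{1,2}(Ω)`. -/
def W12.EqOneOnBoundary {Ω : Set Plane} (u : W12 Ω) : Prop :=
  ∃ ψ : ℕ → Plane → ℝ, (∀ k, IsTestFunction Ω (ψ k)) ∧
    Tendsto (fun k => eLpNorm (fun x => (u.val x - 1) - ψ k x) 2 (volume.restrict Ω))
      atTop (𝓝 0) ∧
    Tendsto (fun k => eLpNorm (fun x => u.grad x - gradient (ψ k) x) 2 (volume.restrict Ω))
      atTop (𝓝 0)

/-- `div σ = f` weakly on `ℝ²`, where `σ ∈ L²(Ω; ℝ²)` is extended by zero outside `Ω`; the test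
functions need not vanish on `∂Ω`. -/
def HasWeakDivergence (Ω : Set Plane) (σ : L2 Ω Plane) (f : Plane → ℝ) : Prop :=
  ∀ ψ : Plane → ℝ, ContDiff ℝ 1 ψ → HasCompactSupport ψ →
    ∫ x, ψ x * f x = -∫ x in Ω, inner ℝ (gradient ψ x) (σ x)

/-- `μ` is a probability measure with compact support in `Ω`; if `α₀ = ∞` it is moreover a finite
linear combination of Dirac masses. -/
structure IsAdmissible (Ω : Set Plane) (α₀ : ℝ≥0∞) (μ : Measure Plane) : Prop where
  isProbabilityMeasure : IsProbabilityMeasure μ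
  isCompact_support : IsCompact μ.support
  support_subset : μ.support ⊆ Ω
  dirac_of_eq_top : α₀ = ⊤ →
    ∃ (s : Finset Plane) (c : Plane → ℝ≥0), μ = ∑ x ∈ s, c x • Measure.dirac x

/-- Smooth convolution kernel with support in the unit disk and unit mass. -/
structure IsKernel (ρ : Plane → ℝ) : Prop where
  contDiff : ContDiff ℝ ∞ ρ
  nonneg : ∀ x, 0 ≤ ρ x
  tsupport_subset : tsupport ρ ⊆ Metric.closedBall 0 1
  integral_eq_one : ∫ x, ρ x = 1

/-- The density of `ρ_ε * μ`, where `ρ_ε = ε⁻² ρ(·/ε)`. -/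
def smoothed (ρ : Plane → ℝ) (ε : ℝ) (μ : Measure Plane) (x : Plane) : ℝ :=
  ∫ y, (ε ^ 2)⁻¹ * ρ (ε⁻¹ • (x - y)) ∂μ

/-- The admissible set: pairs `(σ, (φ₁, …, φ_N))` in `L²(Ω; ℝ²) × W^{1,2}(Ω)^N` with
`div σ = ρ_ε * μ₊ - ρ_ε * μ₋` and `φ₁ = … = φ_N = 1` on `∂Ω`. -/
def admissibleSet (Ω : Set Plane) (N : ℕ) (ρ : Plane → ℝ) (ε : ℝ) (μp μm : Measure Plane) :
    Set (L2 Ω Plane × (Fin N → W12 Ω)) :=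
  {w | HasWeakDivergence Ω w.1 (fun x => smoothed ρ ε μp x - smoothed ρ ε μm x) ∧
    ∀ i, (w.2 i).EqOneOnBoundary}

/-- `γ_ε(x) = min_i (φ_i(x)² + α_i² ε² / β_i)`. -/
def gam {Ω : Set Plane} {N : ℕ} (α β : Fin N → ℝ) (ε : ℝ) (φ : Fin N → W12 Ω) (x : Plane) : ℝ :=
  ⨅ i, ((φ i).val x ^ 2 + α i ^ 2 * ε ^ 2 / β i)

/-- The integrand `ω_ε(α₀, g, s)`, where `α₀ = ∞` is allowed; `g` stands for `γ_ε(x)/ε` and `s`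
for `|σ(x)|`. -/
def omega (ε p : ℝ) (α₀ : ℝ≥0∞) (g s : ℝ) : ℝ :=
  if α₀ = ⊤ then g * (s ^ 2 / 2)
  else (if s ≤ α₀.toReal / g then g * (s ^ 2 / 2)
      else α₀.toReal * (s - α₀.toReal / (2 * g))) + ε ^ p * s ^ 2

/-- `L_ε[φ] = ½ ∫_Ω (ε |∇φ|² + (φ - 1)² / ε) dx`, as an element of `[0, ∞]`. -/
def LEnergy {Ω : Set Plane} (ε : ℝ) (φ : W12 Ω) : ℝ≥0∞ :=
  ∫⁻ x in Ω, ENNReal.ofReal ((ε * ‖φ.grad x‖ ^ 2 + (φ.val x - 1) ^ 2 / ε) / 2)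

/-- The phase field cost functional, as an element of `[0, ∞]`. -/
def energy {Ω : Set Plane} {N : ℕ} (α₀ : ℝ≥0∞) (α β : Fin N → ℝ) (ε p : ℝ)
    (w : L2 Ω Plane × (Fin N → W12 Ω)) : ℝ≥0∞ :=
  (∫⁻ x in Ω, ENNReal.ofReal (omega ε p α₀ (gam α β ε w.2 x / ε) ‖w.1 x‖)) +
    ∑ i, ENNReal.ofReal (β i) * LEnergy ε (w.2 i)

end PhaseField

end

namespace PhaseField

/-! ### The Poincaré inequality on connected domains whose boundary is locally a graph -/

/-! The proof is the direct method in the Hilbert space of `σ` and the jets `(φ_i - 1, ∇φ_i)`.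

A competitor of finite energy is `φ_i = 1` together with any `σ` solving the divergence equation.
Write `f` for the difference of the smoothed measures. It is bounded and continuous, has integral
zero, and vanishes off `Ω`. By Hahn–Banach and Riesz, `σ` exists once `|∫_Ω ψ f| ≤ C ‖∇ψ‖_{L²(Ω)}`
(`exists_inner_eq_of_bound`). Since `f` is bounded with mean zero, this follows from an `L¹`
Poincaré inequality, the bound of `∬ |ψ(x) - ψ(y)|` by `∫ |∇ψ|` in
`HasLipschitzBoundary.oscillationBound`. That inequality comes from chains of balls inside `Ω`, and
from translating boundary pieces into the interior along the graph direction.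

On energy sublevels `σ` and the jets are bounded: `gam` has a positive lower bound, and for finite
`α₀` the term `ε^p s²` supplies the quadratic growth in `σ`. So a minimizing sequence has a weakly
convergent subsequence. The divergence equation, the weak gradient relation and the boundary
condition are linear up to a constant and pass to weak limits.

The phase field terms are convex, hence weakly lower semicontinuous. The coupling term is not
handled by joint convexity. Rellich's theorem for `W₀^{1,2}` gives almost everywhere convergence of
the `φ_i`, hence of the weights. The integrand is bounded below by functions affine in `σ` that
touch it at the limit and depend on the weight `g` only through `1/g` (`le_omega`, `omega_eq`).
Their integrals converge by pairing weak with strong convergence (`lintegral_omega_le_liminf`). -/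

theorem enorm_add_sub_le_lintegral {ψ : Plane → ℝ} (hψ : ContDiff ℝ 1 ψ) (x v : Plane) :
    ‖ψ (x + v) - ψ x‖ₑ ≤ ‖v‖ₑ * ∫⁻ t in Set.Icc (0 : ℝ) 1, ‖fderiv ℝ ψ (x + t • v)‖ₑ := by
  have hl : ∀ t : ℝ, HasDerivAt (fun t : ℝ => ψ (x + t • v)) (fderiv ℝ ψ (x + t • v) v) t := by
    intro t
    have h1 : HasDerivAt (fun t : ℝ => x + t • v) v t := by
      simpa using ((hasDerivAt_id t).smul_const v).const_add x
    exact ((hψ.differentiable one_ne_zero _).hasFDerivAt).comp_hasDerivAt t h1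
  have h := enorm_sub_le_lintegral_deriv_of_contDiffOn_Icc (a := 0) (b := 1)
    (f := fun t : ℝ => ψ (x + t • v)) (by fun_prop) zero_le_one
  simp only [one_smul, zero_smul, add_zero] at h
  refine h.trans ?_
  rw [← lintegral_const_mul' _ _ enorm_ne_top]
  refine lintegral_mono fun t => ?_
  rw [(hl t).deriv, mul_comm]
  exact ContinuousLinearMap.le_opENorm _ _

theorem measurable_enorm_fderiv_line {ψ : Plane → ℝ} (hψ : ContDiff ℝ 1 ψ) (v : Plane) :
    Measurable fun q : Plane × ℝ => ‖fderiv ℝ ψ (q.1 + q.2 • v)‖ₑ := by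
  have : Continuous (fderiv ℝ ψ) := hψ.continuous_fderiv one_ne_zero
  exact (by fun_prop : Continuous fun q : Plane × ℝ => ‖fderiv ℝ ψ (q.1 + q.2 • v)‖ₑ).measurable

/-- Translation estimate: if all segments from `x` to `x + v`, `x ∈ A`, lie in `Ω`, then the
`L¹(A)` distance of `ψ` to its translate is controlled by the gradient on `Ω`. -/
theorem lintegral_enorm_translate_sub_le {ψ : Plane → ℝ} (hψ : ContDiff ℝ 1 ψ) {Ω A : Set Plane}
    (hΩ : MeasurableSet Ω) (hA : MeasurableSet A) (v : Plane)
    (hseg : ∀ x ∈ A, ∀ t ∈ Set.Icc (0 : ℝ) 1, x + t • v ∈ Ω) :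
    ∫⁻ x in A, ‖ψ (x + v) - ψ x‖ₑ ≤ ‖v‖ₑ * ∫⁻ x in Ω, ‖fderiv ℝ ψ x‖ₑ := by
  calc ∫⁻ x in A, ‖ψ (x + v) - ψ x‖ₑ
      ≤ ∫⁻ x in A, ‖v‖ₑ * ∫⁻ t in Set.Icc (0 : ℝ) 1, ‖fderiv ℝ ψ (x + t • v)‖ₑ :=
        lintegral_mono fun x => enorm_add_sub_le_lintegral hψ x v
    _ = ‖v‖ₑ * ∫⁻ t in Set.Icc (0 : ℝ) 1, ∫⁻ x in A, ‖fderiv ℝ ψ (x + t • v)‖ₑ := by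
        rw [lintegral_const_mul' _ _ enorm_ne_top, lintegral_lintegral_swap]
        exact (measurable_enorm_fderiv_line hψ v).aemeasurable
    _ ≤ ‖v‖ₑ * ∫⁻ t in Set.Icc (0 : ℝ) 1, ∫⁻ x in Ω, ‖fderiv ℝ ψ x‖ₑ := by
        gcongr ‖v‖ₑ * ?_
        refine setLIntegral_mono' measurableSet_Icc fun t ht => ?_
        rw [← lintegral_indicator hA, ← lintegral_indicator hΩ,
          ← lintegral_add_right_eq_self (Ω.indicator fun x => ‖fderiv ℝ ψ x‖ₑ) (t • v)]
        refine lintegral_mono fun x => ?_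
        by_cases hx : x ∈ A
        · simp [hx, hseg x hx t ht]
        · simp [hx]
    _ = ‖v‖ₑ * ∫⁻ x in Ω, ‖fderiv ℝ ψ x‖ₑ := by simp

/-- The mean oscillation between `A` and `B` is controlled by the gradient on `Ω`. -/
def OscillationBound (Ω A B : Set Plane) : Prop :=
  ∃ C : ℝ≥0, ∀ ψ : Plane → ℝ, ContDiff ℝ 1 ψ →
    ∫⁻ x in A, ∫⁻ y in B, ‖ψ x - ψ y‖ₑ ≤ C * ∫⁻ x in Ω, ‖fderiv ℝ ψ x‖ₑ

theorem measurable_enorm_sub {ψ : Plane → ℝ} (hψ : ContDiff ℝ 1 ψ) :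
    Measurable fun q : Plane × Plane => ‖ψ q.1 - ψ q.2‖ₑ := by
  have := hψ.continuous
  exact (by fun_prop : Continuous fun q : Plane × Plane => ‖ψ q.1 - ψ q.2‖ₑ).measurable

theorem OscillationBound.symm {Ω A B : Set Plane} (h : OscillationBound Ω A B) :
    OscillationBound Ω B A := by
  obtain ⟨C, hC⟩ := h
  refine ⟨C, fun ψ hψ => ?_⟩
  rw [lintegral_lintegral_swap (measurable_enorm_sub hψ).aemeasurable]
  simpa only [← edist_eq_enorm_sub, edist_comm] using hC ψ hψ

theorem OscillationBound.mono {Ω A B A' B' : Set Plane} (h : OscillationBound Ω A B)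
    (hA : A' ⊆ A) (hB : B' ⊆ B) : OscillationBound Ω A' B' := by
  obtain ⟨C, hC⟩ := h
  refine ⟨C, fun ψ hψ => le_trans ?_ (hC ψ hψ)⟩
  exact (lintegral_mono fun x => lintegral_mono_set hB).trans (lintegral_mono_set hA)

/-- The triangle inequality through a third point `z`, integrated over `z ∈ D`. It makes oscillation
bounds transitive through any set of positive finite measure. -/
theorem lintegral_enorm_sub_mul_le {ψ : Plane → ℝ} (hψ : ContDiff ℝ 1 ψ) (A B D : Set Plane) :
    (∫⁻ x in A, ∫⁻ y in B, ‖ψ x - ψ y‖ₑ) * volume D ≤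
      (∫⁻ x in A, ∫⁻ z in D, ‖ψ x - ψ z‖ₑ) * volume B +
        (∫⁻ z in D, ∫⁻ y in B, ‖ψ z - ψ y‖ₑ) * volume A := by
  have hc := hψ.continuous
  have m1 : ∀ x, Measurable fun y => ‖ψ x - ψ y‖ₑ := fun x =>
    (by fun_prop : Continuous fun y => ‖ψ x - ψ y‖ₑ).measurable
  have m2 : ∀ S : Set Plane, Measurable fun x => ∫⁻ y in S, ‖ψ x - ψ y‖ₑ := fun S =>
    Measurable.lintegral_prod_right' (measurable_enorm_sub hψ)
  have key : ∀ x y, ‖ψ x - ψ y‖ₑ * volume D ≤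
      (∫⁻ z in D, ‖ψ x - ψ z‖ₑ) + ∫⁻ z in D, ‖ψ y - ψ z‖ₑ := by
    intro x y
    rw [← lintegral_add_left (m1 x), ← setLIntegral_const]
    refine lintegral_mono fun z => ?_
    simp only [← edist_eq_enorm_sub]
    exact edist_triangle_right _ _ _
  calc (∫⁻ x in A, ∫⁻ y in B, ‖ψ x - ψ y‖ₑ) * volume D
      = ∫⁻ x in A, ∫⁻ y in B, ‖ψ x - ψ y‖ₑ * volume D := by
        rw [← lintegral_mul_const _ (m2 B)]
        simp_rw [lintegral_mul_const _ (m1 _)]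
    _ ≤ ∫⁻ x in A, ∫⁻ y in B, ((∫⁻ z in D, ‖ψ x - ψ z‖ₑ) + ∫⁻ z in D, ‖ψ y - ψ z‖ₑ) :=
        lintegral_mono fun x => lintegral_mono fun y => key x y
    _ = (∫⁻ x in A, ∫⁻ z in D, ‖ψ x - ψ z‖ₑ) * volume B +
        (∫⁻ y in B, ∫⁻ z in D, ‖ψ y - ψ z‖ₑ) * volume A := by
        simp_rw [lintegral_add_left measurable_const, setLIntegral_const]
        rw [lintegral_add_left ((m2 D).mul_const _), lintegral_mul_const _ (m2 D),
          setLIntegral_const]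
    _ = _ := by
        rw [lintegral_lintegral_swap (μ := volume.restrict B)
          (measurable_enorm_sub hψ).aemeasurable]
        simp only [← edist_eq_enorm_sub, edist_comm]

theorem OscillationBound.trans {Ω A B D : Set Plane} (h : OscillationBound Ω A D)
    (h' : OscillationBound Ω D B) (hA : volume A ≠ ⊤) (hB : volume B ≠ ⊤) (hD : volume D ≠ ⊤)
    (hD0 : volume D ≠ 0) : OscillationBound Ω A B := by
  obtain ⟨C, hC⟩ := h
  obtain ⟨C', hC'⟩ := h'
  refine ⟨(C * (volume B).toNNReal + C' * (volume A).toNNReal) / (volume D).toNNReal,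
    fun ψ hψ => ?_⟩
  have hD0' : (volume D).toNNReal ≠ 0 := by
    simpa [ENNReal.toNNReal_eq_zero_iff] using ⟨hD0, hD⟩
  rw [ENNReal.coe_div hD0', ENNReal.coe_add, ENNReal.coe_mul, ENNReal.coe_mul,
    ENNReal.coe_toNNReal hA, ENNReal.coe_toNNReal hB, ENNReal.coe_toNNReal hD,
    ENNReal.mul_comm_div, mul_comm, ENNReal.mul_comm_div, ← mul_div_assoc,
    ENNReal.le_div_iff_mul_le (Or.inl hD0) (Or.inl hD)]
  refine (lintegral_enorm_sub_mul_le hψ A B D).trans ?_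
  calc _ ≤ (C * ∫⁻ x in Ω, ‖fderiv ℝ ψ x‖ₑ) * volume B +
        (C' * ∫⁻ x in Ω, ‖fderiv ℝ ψ x‖ₑ) * volume A := by
        gcongr
        · exact hC ψ hψ
        · exact hC' ψ hψ
    _ = _ := by ring

theorem oscillationBound_empty (Ω B : Set Plane) : OscillationBound Ω ∅ B :=
  ⟨0, fun ψ _ => by simp⟩

theorem OscillationBound.union {Ω A A' B : Set Plane} (h : OscillationBound Ω A B)
    (h' : OscillationBound Ω A' B) : OscillationBound Ω (A ∪ A') B := by
  obtain ⟨C, hC⟩ := h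
  obtain ⟨C', hC'⟩ := h'
  refine ⟨C + C', fun ψ hψ => (lintegral_union_le _ _ _).trans ?_⟩
  rw [ENNReal.coe_add, add_mul]
  exact add_le_add (hC ψ hψ) (hC' ψ hψ)

/-- Substituting `y = x + v` turns the double integral into an integral over `v` of translation
differences. Convexity of the ball keeps the segments inside `Ω`. -/
theorem oscillationBound_ball {Ω : Set Plane} (hΩ : MeasurableSet Ω) {a : Plane} {r : ℝ}
    (hsub : Metric.ball a r ⊆ Ω) :
    OscillationBound Ω (Metric.ball a r) (Metric.ball a r) := by
  set V := Metric.ball (0 : Plane) (2 * r)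
  have hV : volume V ≠ ⊤ := measure_ball_lt_top.ne
  refine ⟨(volume V).toNNReal * (2 * r).toNNReal, fun ψ hψ => ?_⟩
  set A := Metric.ball a r
  have hc := hψ.continuous
  have mA : MeasurableSet A := Metric.isOpen_ball.measurableSet
  have mV : MeasurableSet V := Metric.isOpen_ball.measurableSet
  -- Both endpoints must stay in the ball, which forces `‖v‖ < 2 * r` and so `v ∈ V`.
  set S : Plane → Set Plane := fun v => {x | x ∈ A ∧ x + v ∈ A}
  have mS : ∀ v, MeasurableSet (S v) := fun v =>
    mA.inter ((measurable_id.add_const v) mA)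
  have step : ∀ x ∈ A, ∫⁻ y in A, ‖ψ x - ψ y‖ₑ =
      ∫⁻ v in V, (S v).indicator (fun x => ‖ψ (x + v) - ψ x‖ₑ) x := by
    intro x hx
    rw [← lintegral_indicator mA, ← lintegral_indicator mV,
      ← lintegral_add_left_eq_self (A.indicator fun y => ‖ψ x - ψ y‖ₑ) x]
    refine lintegral_congr fun v => ?_
    by_cases hv : x + v ∈ A
    · have hvV : v ∈ V := by
        have h1 : dist (x + v) a < r := hv
        have h2 : dist x a < r := hx
        have : dist (x + v) x < 2 * r := by
          linarith [dist_triangle_right (x + v) x a]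
        simpa [V, dist_eq_norm] using this
      rw [Set.indicator_of_mem hv, Set.indicator_of_mem hvV,
        Set.indicator_of_mem (show x ∈ S v from ⟨hx, hv⟩), ← edist_eq_enorm_sub,
        ← edist_eq_enorm_sub, edist_comm]
    · have : x ∉ S v := fun h => hv h.2
      rw [Set.indicator_of_notMem hv]
      by_cases hvV : v ∈ V
      · rw [Set.indicator_of_mem hvV, Set.indicator_of_notMem this]
      · rw [Set.indicator_of_notMem hvV]
  have hmeas : Measurable fun q : Plane × Plane =>
      (S q.2).indicator (fun x => ‖ψ (x + q.2) - ψ x‖ₑ) q.1 := by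
    have : (fun q : Plane × Plane => (S q.2).indicator (fun x => ‖ψ (x + q.2) - ψ x‖ₑ) q.1) =
        {q : Plane × Plane | q.1 ∈ A ∧ q.1 + q.2 ∈ A}.indicator
          (fun q => ‖ψ (q.1 + q.2) - ψ q.1‖ₑ) := rfl
    rw [this]
    exact (by fun_prop : Continuous fun q : Plane × Plane =>
      ‖ψ (q.1 + q.2) - ψ q.1‖ₑ).measurable.indicator
      ((measurable_fst mA).inter ((measurable_fst.add measurable_snd) mA))
  rw [setLIntegral_congr_fun mA step, lintegral_lintegral_swap hmeas.aemeasurable]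
  calc ∫⁻ v in V, ∫⁻ x in A, (S v).indicator (fun x => ‖ψ (x + v) - ψ x‖ₑ) x
      ≤ ∫⁻ v in V, ENNReal.ofReal (2 * r) * ∫⁻ x in Ω, ‖fderiv ℝ ψ x‖ₑ := by
        refine setLIntegral_mono' mV fun v hv => ?_
        have hv' : ‖v‖ₑ ≤ ENNReal.ofReal (2 * r) := by
          rw [← ofReal_norm]
          exact ENNReal.ofReal_le_ofReal (mem_ball_zero_iff.1 hv).le
        refine (setLIntegral_le_lintegral _ _).trans ?_
        rw [lintegral_indicator (mS v)]
        refine (lintegral_enorm_translate_sub_le hψ hΩ (mS v) v fun x hx t ht => hsub ?_).trans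
          (by gcongr)
        have := (convex_ball a r) hx.1 hx.2 (sub_nonneg.2 ht.2) ht.1 (by ring)
        convert this using 1
        module
    _ = _ := by
        rw [setLIntegral_const, ENNReal.coe_mul, ENNReal.coe_toNNReal hV]
        simp only [ENNReal.ofReal]
        ring

/-- The usual chain of balls, run as an induction on connectedness: the relation holds between
nearby points and is symmetric and transitive. -/
theorem exists_oscillationBound_balls {Ω : Set Plane} (hΩo : IsOpen Ω) (hΩc : IsPreconnected Ω)
    {x y : Plane} (hx : x ∈ Ω) (hy : y ∈ Ω) :
    ∃ r > 0, ∃ s > 0, OscillationBound Ω (Metric.ball x r) (Metric.ball y s) := by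
  refine hΩc.induction₂ (fun x y => ∃ r > 0, ∃ s > 0,
    OscillationBound Ω (Metric.ball x r) (Metric.ball y s)) ?_ ?_ ?_ hx hy
  · intro x hx
    obtain ⟨R, hR, hsub⟩ := Metric.isOpen_iff.1 hΩo x hx
    filter_upwards [mem_nhdsWithin_of_mem_nhds (Metric.ball_mem_nhds x (half_pos hR))] with y hy
    have hy' : dist y x < R / 2 := hy
    refine ⟨R, hR, R / 2, half_pos hR,
      (oscillationBound_ball hΩo.measurableSet hsub).mono le_rfl ?_⟩
    exact Metric.ball_subset_ball' (by linarith)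
  · rintro x y z - - - ⟨r, hr, s, hs, h⟩ ⟨r', hr', s', hs', h'⟩
    refine ⟨r, hr, s', hs', ?_⟩
    have hm : 0 < min s r' := lt_min hs hr'
    refine (h.mono le_rfl (Metric.ball_subset_ball (min_le_left s r'))).trans
      (h'.mono (Metric.ball_subset_ball (min_le_right s r')) le_rfl) measure_ball_lt_top.ne
      measure_ball_lt_top.ne measure_ball_lt_top.ne (Metric.measure_ball_pos _ _ hm).ne'
  · rintro x y - - ⟨r, hr, s, hs, h⟩
    exact ⟨s, hs, r, hr, h.symm⟩

/-- The direction pointing out of `Ω` in the graph coordinates `T`. -/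
theorem exists_vertical (T : Plane ≃ₗᵢ[ℝ] Plane) :
    ∃ e : Plane, ‖e‖ = 1 ∧ ∀ (x : Plane) (s : ℝ), T (x + s • e) 0 = T x 0 ∧
      T (x + s • e) 1 = T x 1 + s := by
  refine ⟨T.symm (EuclideanSpace.single 1 1), by simp, fun x s => ?_⟩
  simp

/-- The vector `e` is the upward unit vector of the graph coordinates. Moving down stays below the
graph, which serves the Poincaré inequality; moving up from a boundary point leaves the closure,
which serves to show that the source vanishes on the boundary. -/
theorem HasLipschitzBoundary.exists_shift {Ω : Set Plane} (hΩo : IsOpen Ω)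
    (hΩl : HasLipschitzBoundary Ω) {x₀ : Plane} (hx₀ : x₀ ∈ frontier Ω) :
    ∃ (e : Plane) (r : ℝ), 0 < r ∧ ‖e‖ = 1 ∧
      (∀ x ∈ Ω ∩ Metric.ball x₀ r, ∀ s ∈ Set.Icc 0 r, x - s • e ∈ Ω) ∧
      (∀ s ∈ Set.Ioc 0 r, x₀ - s • e ∈ Ω) ∧ (∀ s ∈ Set.Ioc 0 r, x₀ + s • e ∉ closure Ω) := by
  obtain ⟨T, K, h, r, hLip, hr, hgraph⟩ := hΩl x₀ hx₀
  obtain ⟨e, he, hTe⟩ := exists_vertical T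
  have hc := hLip.continuous
  have hx₀' : x₀ ∈ Metric.ball x₀ r := Metric.mem_ball_self hr
  -- The part of the closure inside the chart lies in the closed subgraph, by continuity of `h`.
  have hle : ∀ x ∈ closure Ω ∩ Metric.ball x₀ r, T x 1 ≤ h (T x 0) := by
    intro x hx
    have hcl : IsClosed {x : Plane | T x 1 ≤ h (T x 0)} :=
      isClosed_le (by fun_prop) (by fun_prop)
    have h1 : x ∈ closure (Ω ∩ Metric.ball x₀ r) := by
      rw [Set.inter_comm]
      exact Metric.isOpen_ball.inter_closure ⟨hx.2, hx.1⟩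
    exact (closure_minimal (fun x hx => ((hgraph x hx.2).1 hx.1).le) hcl) h1
  have hge : h (T x₀ 0) ≤ T x₀ 1 := by
    rw [hΩo.frontier_eq] at hx₀
    exact not_lt.1 fun hlt => hx₀.2 ((hgraph x₀ hx₀').2 hlt)
  have hball : ∀ x ∈ Metric.ball x₀ (r / 4), ∀ s ∈ Set.Icc (-(r / 4)) (r / 4),
      x + s • e ∈ Metric.ball x₀ r := by
    intro x hx s hs
    have h1 : dist (x + s • e) x ≤ r / 4 := by
      simpa [dist_eq_norm, norm_smul, he] using abs_le.2 hs
    have h2 : dist x x₀ < r / 4 := hx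
    rw [Metric.mem_ball]
    linarith [dist_triangle (x + s • e) x x₀]
  have hself : x₀ ∈ Metric.ball x₀ (r / 4) := Metric.mem_ball_self (by positivity)
  -- With radius `r / 4`, points and their shifts remain inside the chart ball of radius `r`.
  refine ⟨e, r / 4, by positivity, he, fun x hx s hs => ?_, fun s hs => ?_, fun s hs hmem => ?_⟩
  · have hb := hball x hx.2 (-s) ⟨by linarith [hs.2], by linarith [hs.1, hs.2]⟩
    have hxT := (hgraph x (by simpa using hball x hx.2 0 ⟨by linarith, by linarith⟩)).1 hx.1
    rw [sub_eq_add_neg, ← neg_smul, hgraph _ hb, (hTe x _).1, (hTe x _).2]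
    linarith [hs.1]
  · have hb := hball x₀ hself (-s) ⟨by linarith [hs.2], by linarith [hs.1, hs.2]⟩
    rw [sub_eq_add_neg, ← neg_smul, hgraph _ hb, (hTe x₀ _).1, (hTe x₀ _).2]
    linarith [hs.1, hle x₀ ⟨frontier_subset_closure hx₀, hx₀'⟩]
  · have hb := hball x₀ hself s ⟨by linarith [hs.1], hs.2⟩
    have := hle _ ⟨hmem, hb⟩
    rw [(hTe x₀ _).1, (hTe x₀ _).2] at this
    linarith [hs.1]

/-- Translation by `-(r • e)` carries the piece of `Ω` near `x₀` into a ball around the interior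
point `x₀ - r • e`, where the chain of balls applies. The translation itself costs only the
gradient, since the segments stay in `Ω`. -/
theorem HasLipschitzBoundary.exists_oscillationBound_frontier {Ω : Set Plane} (hΩo : IsOpen Ω)
    (hΩc : IsPreconnected Ω) (hΩl : HasLipschitzBoundary Ω) {x₀ z : Plane} (hz : z ∈ Ω)
    (hx₀ : x₀ ∈ frontier Ω) :
    ∃ r > 0, ∃ s > 0, OscillationBound Ω (Ω ∩ Metric.ball x₀ r) (Metric.ball z s) := by
  obtain ⟨e, r, hr, he, hseg, hin, -⟩ := hΩl.exists_shift hΩo hx₀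
  obtain ⟨r₁, hr₁, s, hs, C, hC⟩ :=
    exists_oscillationBound_balls hΩo hΩc (hin r ⟨hr, le_rfl⟩) hz
  have hB : volume (Metric.ball z s) ≠ ⊤ := measure_ball_lt_top.ne
  refine ⟨min r r₁, lt_min hr hr₁, s, hs,
    r.toNNReal * (volume (Metric.ball z s)).toNNReal + C, fun ψ hψ => ?_⟩
  set B := Metric.ball z s
  set v : Plane := -(r • e)
  set A := Ω ∩ Metric.ball x₀ (min r r₁)
  have mA : MeasurableSet A := (hΩo.inter Metric.isOpen_ball).measurableSet
  have hc := hψ.continuous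
  have hv : ‖v‖ₑ = ENNReal.ofReal r := by
    rw [← ofReal_norm]
    simp [v, norm_smul, he, abs_of_pos hr]
  have m2 : ∀ x, Measurable fun y => ‖ψ x - ψ y‖ₑ := fun x =>
    (by fun_prop : Continuous fun y => ‖ψ x - ψ y‖ₑ).measurable
  have m1 : Measurable fun x => ‖ψ (x + v) - ψ x‖ₑ :=
    (by fun_prop : Continuous fun x => ‖ψ (x + v) - ψ x‖ₑ).measurable
  calc ∫⁻ x in A, ∫⁻ y in B, ‖ψ x - ψ y‖ₑ
      ≤ ∫⁻ x in A, (‖ψ (x + v) - ψ x‖ₑ * volume B + ∫⁻ y in B, ‖ψ (x + v) - ψ y‖ₑ) := by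
        refine lintegral_mono fun x => ?_
        rw [← setLIntegral_const, ← lintegral_add_left measurable_const]
        refine lintegral_mono fun y => ?_
        simp only [← edist_eq_enorm_sub]
        exact edist_triangle_left _ _ _
    _ = (∫⁻ x in A, ‖ψ (x + v) - ψ x‖ₑ) * volume B +
          ∫⁻ x in A, ∫⁻ y in B, ‖ψ (x + v) - ψ y‖ₑ := by
        rw [lintegral_add_left (m1.mul_const _), lintegral_mul_const _ m1]
    _ ≤ (ENNReal.ofReal r * ∫⁻ x in Ω, ‖fderiv ℝ ψ x‖ₑ) * volume B +
          C * ∫⁻ x in Ω, ‖fderiv ℝ ψ x‖ₑ := by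
        gcongr
        · rw [← hv]
          refine lintegral_enorm_translate_sub_le hψ hΩo.measurableSet mA v fun x hx t ht => ?_
          have := hseg x ⟨hx.1, Metric.ball_subset_ball (min_le_left _ _) hx.2⟩ (t * r)
            ⟨mul_nonneg ht.1 hr.le, mul_le_of_le_one_left hr.le ht.2⟩
          simpa [v, sub_eq_add_neg, smul_smul] using this
        · refine le_trans ?_ (hC ψ hψ)
          rw [← lintegral_indicator mA, ← lintegral_indicator Metric.isOpen_ball.measurableSet,
            ← lintegral_add_right_eq_self ((Metric.ball _ r₁).indicator _) v]
          refine lintegral_mono fun x => ?_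
          by_cases hx : x ∈ A
          · have : x + v ∈ Metric.ball (x₀ - r • e) r₁ := by
              have h1 : dist x x₀ < r₁ := hx.2.trans_le (min_le_right _ _)
              rw [Metric.mem_ball, dist_eq_norm] at *
              convert h1 using 2
              simp only [v]; abel
            simp [hx, this]
          · simp [hx]
    _ = _ := by
        rw [ENNReal.coe_add, ENNReal.coe_mul, ENNReal.coe_toNNReal hB]
        simp only [ENNReal.ofReal]
        ring

/-- Poincaré's inequality, in the form of a bound for the mean oscillation. -/
theorem HasLipschitzBoundary.oscillationBound {Ω : Set Plane} (hΩo : IsOpen Ω)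
    (hΩc : IsPreconnected Ω) (hΩl : HasLipschitzBoundary Ω) (hΩb : Bornology.IsBounded Ω) :
    OscillationBound Ω Ω Ω := by
  obtain rfl | ⟨z, hz⟩ := Ω.eq_empty_or_nonempty
  · exact oscillationBound_empty _ _
  have hfin : ∀ A ⊆ Ω, volume A ≠ ⊤ := fun A hA => (hΩb.subset hA).measure_lt_top.ne
  have hloc : ∀ x ∈ closure Ω, ∃ t ∈ 𝓝[closure Ω] x, ∃ s > 0,
      OscillationBound Ω (Ω ∩ t) (Metric.ball z s) := by
    intro x hx
    by_cases hxΩ : x ∈ Ω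
    · obtain ⟨r, hr, s, hs, h⟩ := exists_oscillationBound_balls hΩo hΩc hxΩ hz
      exact ⟨_, mem_nhdsWithin_of_mem_nhds (Metric.ball_mem_nhds x hr), s, hs,
        h.mono Set.inter_subset_right le_rfl⟩
    · obtain ⟨r, hr, s, hs, h⟩ := hΩl.exists_oscillationBound_frontier hΩo hΩc hz
        (show x ∈ frontier Ω from ⟨hx, by rwa [hΩo.interior_eq]⟩)
      exact ⟨_, mem_nhdsWithin_of_mem_nhds (Metric.ball_mem_nhds x hr), s, hs, h⟩
  -- Compactness of the closure glues the local bounds; the reference ball around `z` shrinks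
  -- finitely often, so its radius stays positive.
  have hglob : ∃ s > 0, OscillationBound Ω (Ω ∩ closure Ω) (Metric.ball z s) := by
    refine hΩb.isCompact_closure.induction_on
      (p := fun t => ∃ s > 0, OscillationBound Ω (Ω ∩ t) (Metric.ball z s)) ?_ ?_ ?_ hloc
    · exact ⟨1, one_pos, by simpa using oscillationBound_empty _ _⟩
    · rintro t t' htt' ⟨s, hs, h⟩
      exact ⟨s, hs, h.mono (by gcongr) le_rfl⟩
    · rintro t t' ⟨s, hs, h⟩ ⟨s', hs', h'⟩
      refine ⟨min s s', lt_min hs hs', ?_⟩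
      rw [Set.inter_union_distrib_left]
      exact (h.mono le_rfl (Metric.ball_subset_ball (min_le_left _ _))).union
        (h'.mono le_rfl (Metric.ball_subset_ball (min_le_right _ _)))
  obtain ⟨s, hs, h⟩ := hglob
  rw [Set.inter_eq_left.2 subset_closure] at h
  exact h.trans h.symm (hfin _ le_rfl) (hfin _ le_rfl) measure_ball_lt_top.ne
    (Metric.measure_ball_pos _ _ hs).ne'

/-! ### Gradients of `C¹` functions as elements of `L²` -/

theorem norm_gradient (ψ : Plane → ℝ) (x : Plane) : ‖gradient ψ x‖ = ‖fderiv ℝ ψ x‖ := by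
  simp [gradient]

theorem enorm_gradient (ψ : Plane → ℝ) (x : Plane) : ‖gradient ψ x‖ₑ = ‖fderiv ℝ ψ x‖ₑ := by
  rw [← ofReal_norm, norm_gradient, ofReal_norm]

theorem continuous_gradient {ψ : Plane → ℝ} (hψ : ContDiff ℝ 1 ψ) : Continuous (gradient ψ) :=
  (InnerProductSpace.toDual ℝ Plane).symm.continuous.comp (hψ.continuous_fderiv one_ne_zero)

theorem hasCompactSupport_gradient {ψ : Plane → ℝ} (hψ : HasCompactSupport ψ) :
    HasCompactSupport (gradient ψ) :=
  (hψ.fderiv ℝ).comp_left (map_zero (InnerProductSpace.toDual ℝ Plane).symm)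

/-- `C¹` functions with compact support. -/
def compactC1 : Submodule ℝ (Plane → ℝ) where
  carrier := {ψ | ContDiff ℝ 1 ψ ∧ HasCompactSupport ψ}
  add_mem' h h' := ⟨h.1.add h'.1, h.2.add h'.2⟩
  zero_mem' := ⟨contDiff_const, HasCompactSupport.zero⟩
  smul_mem' c _ h := ⟨h.1.const_smul c, h.2.smul_left (f := fun _ => c)⟩

theorem memLp_compactC1 (ψ : compactC1) (Ω : Set Plane) :
    MemLp (ψ : Plane → ℝ) 2 (volume.restrict Ω) :=
  (ψ.2.1.continuous.memLp_of_hasCompactSupport ψ.2.2).restrict Ω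

theorem memLp_gradient_compactC1 (ψ : compactC1) (Ω : Set Plane) :
    MemLp (gradient (ψ : Plane → ℝ)) 2 (volume.restrict Ω) :=
  ((continuous_gradient ψ.2.1).memLp_of_hasCompactSupport
    (hasCompactSupport_gradient ψ.2.2)).restrict Ω

theorem gradient_add' {ψ χ : Plane → ℝ} (hψ : ContDiff ℝ 1 ψ) (hχ : ContDiff ℝ 1 χ) (x : Plane) :
    gradient (ψ + χ) x = gradient ψ x + gradient χ x := by
  simp only [gradient]
  rw [fderiv_add (hψ.differentiable one_ne_zero x) (hχ.differentiable one_ne_zero x), map_add]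

theorem gradient_smul' {ψ : Plane → ℝ} (hψ : ContDiff ℝ 1 ψ) (c : ℝ) (x : Plane) :
    gradient (c • ψ) x = c • gradient ψ x := by
  simp only [gradient]
  rw [fderiv_const_smul (hψ.differentiable one_ne_zero x)]
  simp

/-- A `C¹_c` function as an element of `L²(Ω)`. -/
noncomputable def toL2 (Ω : Set Plane) : compactC1 →ₗ[ℝ] L2 Ω ℝ where
  toFun ψ := (memLp_compactC1 ψ Ω).toLp
  map_add' ψ χ := MemLp.toLp_add (memLp_compactC1 ψ Ω) (memLp_compactC1 χ Ω)
  map_smul' c ψ := MemLp.toLp_const_smul c (memLp_compactC1 ψ Ω)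

/-- The gradient of a `C¹_c` function as an element of `L²(Ω; ℝ²)`. -/
noncomputable def gradL2 (Ω : Set Plane) : compactC1 →ₗ[ℝ] L2 Ω Plane where
  toFun ψ := (memLp_gradient_compactC1 ψ Ω).toLp
  map_add' ψ χ := by
    rw [← MemLp.toLp_add]
    exact MemLp.toLp_congr _ _ (.of_forall fun x => gradient_add' ψ.2.1 χ.2.1 x)
  map_smul' c ψ := by
    rw [RingHom.id_apply, ← MemLp.toLp_const_smul]
    exact MemLp.toLp_congr _ _ (.of_forall fun x => gradient_smul' ψ.2.1 c x)

theorem coeFn_toL2 (Ω : Set Plane) (ψ : compactC1) :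
    toL2 Ω ψ =ᵐ[volume.restrict Ω] (ψ : Plane → ℝ) := MemLp.coeFn_toLp (memLp_compactC1 ψ Ω)

theorem coeFn_gradL2 (Ω : Set Plane) (ψ : compactC1) :
    gradL2 Ω ψ =ᵐ[volume.restrict Ω] gradient (ψ : Plane → ℝ) :=
  MemLp.coeFn_toLp (memLp_gradient_compactC1 ψ Ω)

theorem inner_gradL2 (Ω : Set Plane) (ψ : compactC1) (σ : L2 Ω Plane) :
    inner ℝ (gradL2 Ω ψ) σ = ∫ x in Ω, inner ℝ (gradient (ψ : Plane → ℝ) x) (σ x) := by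
  rw [L2.inner_def]
  refine integral_congr_ae ?_
  filter_upwards [coeFn_gradL2 Ω ψ] with x hx
  rw [hx]

theorem lintegral_enorm_le_eLpNorm_two {Ω : Set Plane} {F : Type} [NormedAddCommGroup F]
    {u : Plane → F} (hu : AEStronglyMeasurable u (volume.restrict Ω)) :
    ∫⁻ x in Ω, ‖u x‖ₑ ≤ eLpNorm u 2 (volume.restrict Ω) * volume Ω ^ (1 / 2 : ℝ) := by
  have := eLpNorm_le_eLpNorm_mul_rpow_measure_univ (p := 1) (q := 2) (by norm_num) hu
  rw [eLpNorm_one_eq_lintegral_enorm] at this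
  refine this.trans_eq ?_
  norm_num

theorem lintegral_enorm_fderiv_le {Ω : Set Plane} (ψ : compactC1) :
    ∫⁻ x in Ω, ‖fderiv ℝ (ψ : Plane → ℝ) x‖ₑ ≤ ‖gradL2 Ω ψ‖ₑ * volume Ω ^ (1 / 2 : ℝ) := by
  have h := lintegral_enorm_le_eLpNorm_two (memLp_gradient_compactC1 ψ Ω).1
  simp only [enorm_gradient] at h
  rwa [← Lp.enorm_toLp (hf := memLp_gradient_compactC1 ψ Ω)] at h

/-! ### Solving the divergence equation -/

/-- The bound makes `l` factor through the range of `G` as a bounded functional, which Hahn–Banach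
extends to `H` and Riesz represents. -/
theorem exists_inner_eq_of_bound {V H : Type*} [AddCommGroup V] [Module ℝ V]
    [NormedAddCommGroup H] [InnerProductSpace ℝ H] [CompleteSpace H] (G : V →ₗ[ℝ] H)
    (l : V →ₗ[ℝ] ℝ) (C : ℝ) (hC : ∀ v, |l v| ≤ C * ‖G v‖) :
    ∃ σ : H, ∀ v, inner ℝ σ (G v) = l v := by
  have hker : LinearMap.ker G ≤ LinearMap.ker l := by
    intro v hv
    have := hC v
    rw [LinearMap.mem_ker.1 hv, norm_zero, mul_zero] at this
    exact abs_nonpos_iff.1 this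
  let m : LinearMap.range G →ₗ[ℝ] ℝ :=
    (LinearMap.ker G).liftQ l hker ∘ₗ G.quotKerEquivRange.symm.toLinearMap
  have hm : ∀ v, m ⟨G v, v, rfl⟩ = l v := by
    intro v
    have : G.quotKerEquivRange.symm ⟨G v, v, rfl⟩ = (LinearMap.ker G).mkQ v := by
      rw [LinearEquiv.symm_apply_eq]
      rfl
    simp [m, this]
  have hmC : ∀ y, ‖m y‖ ≤ C * ‖y‖ := by
    rintro ⟨_, v, rfl⟩
    rw [hm]
    exact hC v
  obtain ⟨g, hg, -⟩ := exists_extension_norm_eq (𝕜 := ℝ) _ (m.mkContinuous C hmC)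
  refine ⟨(InnerProductSpace.toDual ℝ H).symm g, fun v => ?_⟩
  rw [InnerProductSpace.toDual_symm_apply, ← hm v]
  exact hg ⟨G v, v, rfl⟩

/-- Because `f` has mean zero, `|Ω| ∫ ψ f = ∫ f(x) ∫ (ψ(x) - ψ(y)) dy dx`. An `L¹` oscillation bound
suffices because `f` is bounded; Cauchy–Schwarz then passes to the `L²` norm of the gradient. -/
theorem abs_setIntegral_mul_le {Ω : Set Plane} (hosc : OscillationBound Ω Ω Ω)
    (hpos : volume Ω ≠ 0) (hfin : volume Ω ≠ ⊤) {f : Plane → ℝ}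
    (hf : Continuous f) {M : ℝ} (hM : ∀ x, ‖f x‖ ≤ M) (h0 : ∫ x in Ω, f x = 0) :
    ∃ C : ℝ, ∀ ψ : compactC1, |∫ x in Ω, (ψ : Plane → ℝ) x * f x| ≤ C * ‖gradL2 Ω ψ‖ := by
  obtain ⟨C, hC⟩ := hosc
  have hv : 0 < volume.real Ω := ENNReal.toReal_pos hpos hfin
  refine ⟨(volume.real Ω)⁻¹ * (M * (C * (volume Ω ^ (1 / 2 : ℝ)).toReal)), fun ψ => ?_⟩
  have : IsFiniteMeasure (volume.restrict Ω) := ⟨by simpa using hfin.lt_top⟩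
  have hψi : Integrable (ψ : Plane → ℝ) (volume.restrict Ω) :=
    (memLp_compactC1 ψ Ω).integrable (by norm_num)
  have hfi : Integrable f (volume.restrict Ω) :=
    Integrable.of_bound hf.aestronglyMeasurable M (.of_forall hM)
  have hψf : Integrable (fun x => (ψ : Plane → ℝ) x * f x) (volume.restrict Ω) :=
    hψi.mul_bdd (c := M) hf.aestronglyMeasurable (.of_forall hM)
  have hid : volume.real Ω * ∫ x in Ω, (ψ : Plane → ℝ) x * f x =
      ∫ x in Ω, f x * ∫ y in Ω, ((ψ : Plane → ℝ) x - (ψ : Plane → ℝ) y) := by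
    have : ∀ x, f x * ∫ y in Ω, ((ψ : Plane → ℝ) x - (ψ : Plane → ℝ) y) =
        volume.real Ω * ((ψ : Plane → ℝ) x * f x) - (∫ y in Ω, (ψ : Plane → ℝ) y) * f x := by
      intro x
      rw [integral_sub (integrable_const _) hψi, setIntegral_const, smul_eq_mul]
      ring
    simp_rw [this]
    rw [integral_sub (hψf.const_mul _) (hfi.const_mul _), integral_const_mul, integral_const_mul,
      h0, mul_zero, sub_zero]
  have hM0 : 0 ≤ M := (norm_nonneg _).trans (hM 0)
  have hbound : ‖∫ x in Ω, f x * ∫ y in Ω, ((ψ : Plane → ℝ) x - (ψ : Plane → ℝ) y)‖ₑ ≤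
      ENNReal.ofReal M * (C * (‖gradL2 Ω ψ‖ₑ * volume Ω ^ (1 / 2 : ℝ))) := by
    calc _ ≤ ∫⁻ x in Ω, ‖f x * ∫ y in Ω, ((ψ : Plane → ℝ) x - (ψ : Plane → ℝ) y)‖ₑ :=
          enorm_integral_le_lintegral_enorm _
      _ ≤ ∫⁻ x in Ω, ENNReal.ofReal M *
            ∫⁻ y in Ω, ‖(ψ : Plane → ℝ) x - (ψ : Plane → ℝ) y‖ₑ := by
          refine lintegral_mono fun x => ?_
          rw [enorm_mul]
          gcongr
          · rw [← ofReal_norm]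
            exact ENNReal.ofReal_le_ofReal (hM x)
          · exact enorm_integral_le_lintegral_enorm _
      _ ≤ _ := by
          rw [lintegral_const_mul' _ _ ENNReal.ofReal_ne_top]
          gcongr
          refine (hC _ ψ.2.1).trans ?_
          gcongr
          exact lintegral_enorm_fderiv_le ψ
  rw [← hid] at hbound
  have h1 := ENNReal.toReal_mono (by finiteness) hbound
  simp only [toReal_enorm, ENNReal.toReal_mul, ENNReal.toReal_ofReal hM0,
    ENNReal.coe_toReal, Real.norm_eq_abs, abs_mul, abs_of_pos hv] at h1
  rw [mul_assoc, ← div_eq_inv_mul, le_div_iff₀ hv]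
  linarith

theorem exists_hasWeakDivergence {Ω : Set Plane} (hΩo : IsOpen Ω) (hne : Ω.Nonempty)
    (hosc : OscillationBound Ω Ω Ω) (hΩb : Bornology.IsBounded Ω) {f : Plane → ℝ}
    (hf : Continuous f) {M : ℝ} (hM : ∀ x, ‖f x‖ ≤ M) (hoff : ∀ x ∉ Ω, f x = 0)
    (h0 : ∫ x, f x = 0) : ∃ σ : L2 Ω Plane, HasWeakDivergence Ω σ f := by
  rw [← setIntegral_eq_integral_of_forall_compl_eq_zero hoff] at h0
  obtain ⟨C, hC⟩ := abs_setIntegral_mul_le hosc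
    (hΩo.measure_pos volume hne).ne' hΩb.measure_lt_top.ne hf hM h0
  have hint : ∀ ψ : compactC1, IntegrableOn (fun x => (ψ : Plane → ℝ) x * f x) Ω := fun ψ =>
    ((ψ.2.1.continuous.mul hf).integrable_of_hasCompactSupport ψ.2.2.mul_right).integrableOn
  let l : compactC1 →ₗ[ℝ] ℝ :=
    { toFun := fun ψ => ∫ x in Ω, (ψ : Plane → ℝ) x * f x
      map_add' := fun ψ χ => by
        rw [← integral_add (hint ψ) (hint χ)]
        simp [add_mul]
      map_smul' := fun c ψ => by
        simp [mul_assoc, integral_const_mul] }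
  obtain ⟨σ, hσ⟩ := exists_inner_eq_of_bound (gradL2 Ω) l C hC
  refine ⟨-σ, fun ψ hψ hψc => ?_⟩
  have h := hσ ⟨ψ, hψ, hψc⟩
  rw [← inner_gradL2 Ω ⟨ψ, hψ, hψc⟩, inner_neg_right, neg_neg, real_inner_comm, h]
  exact (setIntegral_eq_integral_of_forall_compl_eq_zero fun x hx => by
    rw [hoff x hx, mul_zero]).symm

/-! ### The smoothed measures -/

section smoothed

variable {ρ : Plane → ℝ} {ε : ℝ} {μ : Measure Plane}

theorem IsKernel.hasCompactSupport (hρ : IsKernel ρ) : HasCompactSupport ρ :=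
  (isCompact_closedBall (0 : Plane) 1).of_isClosed_subset (isClosed_tsupport ρ)
    hρ.tsupport_subset

theorem IsKernel.exists_bound (hρ : IsKernel ρ) : ∃ M, ∀ x, ‖ρ x‖ ≤ M :=
  hρ.contDiff.continuous.bounded_above_of_compact_support hρ.hasCompactSupport

theorem norm_smoothed_le [IsProbabilityMeasure μ] {M : ℝ} (hM : ∀ x, ‖ρ x‖ ≤ M) (x : Plane) :
    ‖smoothed ρ ε μ x‖ ≤ (ε ^ 2)⁻¹ * M := by
  have := norm_integral_le_of_norm_le_const (μ := μ) (C := (ε ^ 2)⁻¹ * M)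
    (f := fun y => (ε ^ 2)⁻¹ * ρ (ε⁻¹ • (x - y))) (.of_forall fun y => by
      rw [norm_mul, Real.norm_of_nonneg (by positivity)]
      gcongr
      exact hM _)
  simpa [smoothed] using this

theorem continuous_smoothed [IsProbabilityMeasure μ] (hρ : IsKernel ρ) :
    Continuous (smoothed ρ ε μ) := by
  obtain ⟨M, hM⟩ := hρ.exists_bound
  have hc := hρ.contDiff.continuous
  refine continuous_of_dominated (bound := fun _ => (ε ^ 2)⁻¹ * M) (fun x => ?_) (fun x => ?_)
    (integrable_const _) ?_
  · exact (by fun_prop : Continuous fun y => (ε ^ 2)⁻¹ * ρ (ε⁻¹ • (x - y))).aestronglyMeasurable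
  · refine .of_forall fun y => ?_
    rw [norm_mul, Real.norm_of_nonneg (by positivity)]
    gcongr
    exact hM _
  · exact .of_forall fun y => by fun_prop

theorem IsKernel.integral_scaled (hρ : IsKernel ρ) (hε : 0 < ε) (y : Plane) :
    ∫ x, (ε ^ 2)⁻¹ * ρ (ε⁻¹ • (x - y)) = 1 := by
  rw [integral_const_mul, integral_sub_right_eq_self (fun x => ρ (ε⁻¹ • x)) y,
    Measure.integral_comp_smul, hρ.integral_eq_one]
  have : ε ≠ 0 := hε.ne'
  simp [abs_of_pos hε]
  field_simp

theorem integrable_smoothed_prod [IsProbabilityMeasure μ] (hρ : IsKernel ρ) (hε : 0 < ε) :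
    Integrable (fun q : Plane × Plane => (ε ^ 2)⁻¹ * ρ (ε⁻¹ • (q.1 - q.2)))
      ((volume : Measure Plane).prod μ) := by
  have hc := hρ.contDiff.continuous
  rw [integrable_prod_iff' (by
    exact (by fun_prop : Continuous fun q : Plane × Plane =>
      (ε ^ 2)⁻¹ * ρ (ε⁻¹ • (q.1 - q.2))).aestronglyMeasurable)]
  have hn : ∀ x y : Plane, ‖(ε ^ 2)⁻¹ * ρ (ε⁻¹ • (x - y))‖ = (ε ^ 2)⁻¹ * ρ (ε⁻¹ • (x - y)) :=
    fun x y => Real.norm_of_nonneg (mul_nonneg (by positivity) (hρ.nonneg _))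
  refine ⟨.of_forall fun y => ?_, ?_⟩
  -- A non-integrable function would have integral `0` by convention, whereas this one has integral
  -- `1`.
  · by_contra h
    have := hρ.integral_scaled hε y
    rw [integral_undef h] at this
    exact zero_ne_one this
  · simp_rw [hn, hρ.integral_scaled hε]
    exact integrable_const _

theorem integrable_smoothed [IsProbabilityMeasure μ] (hρ : IsKernel ρ) (hε : 0 < ε) :
    Integrable (smoothed ρ ε μ) := (integrable_smoothed_prod hρ hε).integral_prod_left

theorem integral_smoothed [IsProbabilityMeasure μ] (hρ : IsKernel ρ) (hε : 0 < ε) :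
    ∫ x, smoothed ρ ε μ x = 1 := by
  unfold smoothed
  rw [integral_integral_swap (integrable_smoothed_prod hρ hε)]
  simp_rw [hρ.integral_scaled hε]
  simp

end smoothed

/-- Every boundary point is a limit of points outside the closure, namely `x + s • e` with `s ↓ 0`.
-/
theorem HasLipschitzBoundary.eq_zero_of_notMem {Ω : Set Plane} (hΩo : IsOpen Ω)
    (hΩl : HasLipschitzBoundary Ω) {f : Plane → ℝ} (hf : Continuous f)
    (hoff : ∀ x ∉ closure Ω, f x = 0) : ∀ x ∉ Ω, f x = 0 := by
  intro x hx
  by_cases hxc : x ∈ closure Ω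
  · obtain ⟨e, r, hr, he, -, -, hout⟩ :=
      hΩl.exists_shift hΩo (show x ∈ frontier Ω from ⟨hxc, by rwa [hΩo.interior_eq]⟩)
    have h1 : Tendsto (fun s : ℝ => f (x + s • e)) (𝓝[>] 0) (𝓝 (f x)) := by
      have : Continuous fun s : ℝ => f (x + s • e) := by fun_prop
      simpa using (this.tendsto 0).mono_left nhdsWithin_le_nhds
    refine tendsto_nhds_unique h1 (tendsto_const_nhds.congr' ?_)
    filter_upwards [Ioc_mem_nhdsGT hr] with s hs using (hoff _ (hout s hs)).symm
  · exact hoff x hxc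

/-! ### Weak convergence in Hilbert spaces -/

section WeakTendsto

variable {H : Type*} [NormedAddCommGroup H] [InnerProductSpace ℝ H]

/-- Weak convergence of a sequence in a Hilbert space. -/
def WeakTendsto (x : ℕ → H) (u : H) : Prop :=
  ∀ v, Tendsto (fun n => inner ℝ v (x n)) atTop (𝓝 (inner ℝ v u))

theorem WeakTendsto.comp {x : ℕ → H} {u : H} (h : WeakTendsto x u) {φ : ℕ → ℕ}
    (hφ : StrictMono φ) : WeakTendsto (x ∘ φ) u := fun v => (h v).comp hφ.tendsto_atTop

theorem WeakTendsto.sub {x y : ℕ → H} {u v : H} (h : WeakTendsto x u) (h' : WeakTendsto y v) :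
    WeakTendsto (fun n => x n - y n) (u - v) := fun w => by
  simpa only [inner_sub_right] using (h w).sub (h' w)

theorem weakTendsto_of_tendsto {x : ℕ → H} {u : H} (h : Tendsto x atTop (𝓝 u)) :
    WeakTendsto x u := fun _ => tendsto_const_nhds.inner h

/-- Sequential Banach–Alaoglu in the separable dual picture, transported back by the Riesz isometry.
-/
theorem exists_weakTendsto_subseq [CompleteSpace H] [TopologicalSpace.SeparableSpace H]
    {x : ℕ → H} {C : ℝ} (hC : ∀ n, ‖x n‖ ≤ C) :
    ∃ (u : H) (φ : ℕ → ℕ), StrictMono φ ∧ WeakTendsto (x ∘ φ) u := by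
  obtain ⟨l, -, φ, hφ, hl⟩ := WeakDual.isSeqCompact_closedBall ℝ H 0 C
    (x := fun n => StrongDual.toWeakDual (InnerProductSpace.toDual ℝ H (x n)))
    (fun n => by simpa using hC n)
  refine ⟨(InnerProductSpace.toDual ℝ H).symm (WeakDual.toStrongDual l), φ, hφ, fun v => ?_⟩
  have h := ((WeakDual.eval_continuous (𝕜 := ℝ) v).tendsto l).comp hl
  rw [real_inner_comm, InnerProductSpace.toDual_symm_apply]
  refine h.congr fun n => ?_
  simp [real_inner_comm]

/-- The closure is the double orthogonal complement, hence cut out by equations `⟪v, ·⟫ = 0` that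
survive weak limits. -/
theorem WeakTendsto.mem_topologicalClosure [CompleteSpace H] {M : Submodule ℝ H} {x : ℕ → H}
    {u : H} (h : WeakTendsto x u) (hx : ∀ n, x n ∈ M.topologicalClosure) :
    u ∈ M.topologicalClosure := by
  rw [← Submodule.orthogonal_orthogonal_eq_closure] at hx ⊢
  rw [Submodule.mem_orthogonal]
  intro v hv
  refine tendsto_nhds_unique (h v) (tendsto_const_nhds.congr fun n => ?_)
  exact ((Submodule.mem_orthogonal _ _).1 (hx n) v hv).symm

theorem WeakTendsto.fst {H' : Type*} [NormedAddCommGroup H'] [InnerProductSpace ℝ H']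
    {x : ℕ → WithLp 2 (H × H')} {u : WithLp 2 (H × H')} (h : WeakTendsto x u) :
    WeakTendsto (fun n => (x n).fst) u.fst := fun v => by
  simpa [WithLp.prod_inner_apply] using h (WithLp.toLp 2 (v, 0))

theorem WeakTendsto.snd {H' : Type*} [NormedAddCommGroup H'] [InnerProductSpace ℝ H']
    {x : ℕ → WithLp 2 (H × H')} {u : WithLp 2 (H × H')} (h : WeakTendsto x u) :
    WeakTendsto (fun n => (x n).snd) u.snd := fun v => by
  simpa [WithLp.prod_inner_apply] using h (WithLp.toLp 2 (0, v))

theorem WeakTendsto.apply {ι : Type*} [Fintype ι] {x : ℕ → PiLp 2 fun _ : ι => H}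
    {u : PiLp 2 fun _ : ι => H} (h : WeakTendsto x u) (i : ι) :
    WeakTendsto (fun n => x n i) (u i) := fun v => by
  classical
  have key : ∀ y : PiLp 2 fun _ : ι => H,
      inner ℝ (WithLp.toLp 2 (Pi.single i v) : PiLp 2 fun _ : ι => H) y = inner ℝ v (y i) := by
    intro y
    rw [PiLp.inner_apply, Finset.sum_eq_single i]
    · simp
    · intro j _ hj
      simp [hj]
    · simp
  simpa only [key] using h (WithLp.toLp 2 (Pi.single i v))

end WeakTendsto

/-! ### The space `W₀^{1,2}(Ω)` -/

/-- The graph norm space `L²(Ω) × L²(Ω; ℝ²)` of pairs (function, gradient). -/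
abbrev Jet (Ω : Set Plane) : Type := WithLp 2 (L2 Ω ℝ × L2 Ω Plane)

/-- Test functions on `Ω` as a subspace of `C¹_c`. -/
def testFunctions (Ω : Set Plane) : Submodule ℝ compactC1 where
  carrier := {ψ | IsTestFunction Ω (ψ : Plane → ℝ)}
  add_mem' h h' := ⟨h.1.add h'.1, h.2.1.add h'.2.1,
    (tsupport_add _ _).trans (Set.union_subset h.2.2 h'.2.2)⟩
  zero_mem' := ⟨contDiff_const, HasCompactSupport.zero, by simp [tsupport]⟩
  smul_mem' c ψ h := ⟨h.1.const_smul c, h.2.1.smul_left (f := fun _ => c),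
    (closure_mono (Function.support_const_smul_subset c (ψ : Plane → ℝ))).trans h.2.2⟩

theorem IsTestFunction.mem_compactC1 {Ω : Set Plane} {ψ : Plane → ℝ} (h : IsTestFunction Ω ψ) :
    ψ ∈ compactC1 := ⟨h.1.of_le (by simp), h.2.1⟩

/-- The pair (function, gradient) of a `C¹_c` function. -/
noncomputable def jet (Ω : Set Plane) : compactC1 →ₗ[ℝ] Jet Ω :=
  (WithLp.linearEquiv 2 ℝ (L2 Ω ℝ × L2 Ω Plane)).symm.toLinearMap ∘ₗ (toL2 Ω).prod (gradL2 Ω)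

@[simp] theorem jet_fst (Ω : Set Plane) (ψ : compactC1) : (jet Ω ψ).fst = toL2 Ω ψ := rfl

/-- `W₀^{1,2}(Ω)` as a closed subspace of the space of jets. -/
noncomputable def sobolevZero (Ω : Set Plane) : Submodule ℝ (Jet Ω) :=
  ((testFunctions Ω).map (jet Ω)).topologicalClosure

theorem exists_seq_of_mem_sobolevZero {Ω : Set Plane} {x : Jet Ω} (hx : x ∈ sobolevZero Ω) :
    ∃ ψ : ℕ → compactC1, (∀ k, IsTestFunction Ω (ψ k : Plane → ℝ)) ∧
      Tendsto (fun k => jet Ω (ψ k)) atTop (𝓝 x) := by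
  obtain ⟨y, hy, hlim⟩ := mem_closure_iff_seq_limit.1 hx
  choose ψ hψ hψy using hy
  exact ⟨ψ, hψ, by simpa only [hψy] using hlim⟩

theorem exists_dist_lt_of_mem_sobolevZero {Ω : Set Plane} {x : Jet Ω} (hx : x ∈ sobolevZero Ω)
    {δ : ℝ} (hδ : 0 < δ) : ∃ ψ : compactC1, IsTestFunction Ω (ψ : Plane → ℝ) ∧
      ‖x - jet Ω ψ‖ < δ := by
  obtain ⟨_, ⟨ψ, hψ, rfl⟩, h⟩ := Metric.mem_closure_iff.1 hx δ hδ
  exact ⟨ψ, hψ, by rwa [dist_eq_norm] at h⟩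

/-! ### Rellich's theorem for `W₀^{1,2}(Ω)` -/

theorem lintegral_enorm_fderiv_eq_setLIntegral {Ω : Set Plane} (hΩ : MeasurableSet Ω)
    {ψ : Plane → ℝ} (hψ : tsupport ψ ⊆ Ω) :
    ∫⁻ x, ‖fderiv ℝ ψ x‖ₑ = ∫⁻ x in Ω, ‖fderiv ℝ ψ x‖ₑ := by
  rw [← lintegral_indicator hΩ, Set.indicator_eq_self.2]
  intro x hx
  by_contra h
  refine hx ?_
  simp only
  rw [image_eq_zero_of_notMem_tsupport fun h' => h (hψ (tsupport_fderiv_subset ℝ h'))]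
  exact enorm_zero (E := Plane →L[ℝ] ℝ)

/-- Each `ψ x` is compared with its average over a ball of radius `δ`. Since `ψ` is supported in
`Ω`, the translation estimate applies on the whole plane, with no condition on segments. -/
theorem volume_ball_mul_lintegral_enorm_le {Ω : Set Plane} (hΩ : MeasurableSet Ω)
    {ψ : compactC1} (hψ : tsupport (ψ : Plane → ℝ) ⊆ Ω) {δ : ℝ} :
    volume (Metric.ball (0 : Plane) δ) * ∫⁻ x in Ω, ‖(ψ : Plane → ℝ) x‖ₑ ≤
      volume (Metric.ball (0 : Plane) δ) *
        (ENNReal.ofReal δ * ∫⁻ x in Ω, ‖fderiv ℝ (ψ : Plane → ℝ) x‖ₑ) +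
      ∫⁻ x in Ω, ‖∫ v in Metric.ball (0 : Plane) δ, (ψ : Plane → ℝ) (x + v)‖ₑ := by
  set V := Metric.ball (0 : Plane) δ
  set d : Plane → ℝ := ψ.1
  have hd : Continuous d := ψ.2.1.continuous
  have mV : MeasurableSet V := Metric.isOpen_ball.measurableSet
  have hVfin : IsFiniteMeasure (volume.restrict V) := ⟨by
    rw [Measure.restrict_apply_univ]
    exact measure_ball_lt_top⟩
  have hVr : volume.real V = (volume V).toReal := rfl
  have hVt : volume V ≠ ⊤ := measure_ball_lt_top.ne
  have hdi : Integrable d := hd.integrable_of_hasCompactSupport ψ.2.2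
  have hm : Measurable fun q : Plane × Plane => ‖d (q.1 + q.2) - d q.1‖ₑ :=
    (by fun_prop : Continuous fun q : Plane × Plane => ‖d (q.1 + q.2) - d q.1‖ₑ).measurable
  have hpt : ∀ x, volume V * ‖d x‖ₑ ≤
      (∫⁻ v in V, ‖d (x + v) - d x‖ₑ) + ‖∫ v in V, d (x + v)‖ₑ := by
    intro x
    have e : ∫ v in V, d x = (∫ v in V, d (x + v)) - ∫ v in V, (d (x + v) - d x) := by
      rw [integral_sub (hdi.comp_add_left x).integrableOn (integrable_const _)]
      ring
    calc volume V * ‖d x‖ₑ = ‖∫ v in V, d x‖ₑ := by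
          rw [setIntegral_const, smul_eq_mul, enorm_mul, hVr,
            Real.enorm_eq_ofReal ENNReal.toReal_nonneg, ENNReal.ofReal_toReal hVt]
      _ ≤ _ := by
          rw [e, add_comm]
          exact (enorm_sub_le).trans (by gcongr; exact enorm_integral_le_lintegral_enorm _)
  calc volume V * ∫⁻ x in Ω, ‖d x‖ₑ = ∫⁻ x in Ω, volume V * ‖d x‖ₑ :=
        (lintegral_const_mul' _ _ hVt).symm
    _ ≤ ∫⁻ x in Ω, ((∫⁻ v in V, ‖d (x + v) - d x‖ₑ) + ‖∫ v in V, d (x + v)‖ₑ) :=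
        lintegral_mono hpt
    _ = (∫⁻ v in V, ∫⁻ x in Ω, ‖d (x + v) - d x‖ₑ) + ∫⁻ x in Ω, ‖∫ v in V, d (x + v)‖ₑ := by
        rw [lintegral_add_left (Measurable.lintegral_prod_right' hm),
          lintegral_lintegral_swap hm.aemeasurable]
    _ ≤ _ := by
        gcongr
        calc ∫⁻ v in V, ∫⁻ x in Ω, ‖d (x + v) - d x‖ₑ
            ≤ ∫⁻ v in V, ENNReal.ofReal δ * ∫⁻ x in Ω, ‖fderiv ℝ d x‖ₑ := by
              refine setLIntegral_mono' mV fun v hv => ?_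
              have hv' : ‖v‖ₑ ≤ ENNReal.ofReal δ := by
                rw [← ofReal_norm]
                exact ENNReal.ofReal_le_ofReal (mem_ball_zero_iff.1 hv).le
              refine (lintegral_enorm_translate_sub_le ψ.2.1 .univ hΩ v
                fun _ _ _ _ => Set.mem_univ _).trans ?_
              rw [setLIntegral_univ, lintegral_enorm_fderiv_eq_setLIntegral hΩ hψ]
              gcongr
          _ = _ := by rw [setLIntegral_const, mul_comm]

/-- Local integrals are inner products with fixed `L²` functions, so weak convergence makes them
converge pointwise. -/
theorem setIntegral_ball_translate {Ω : Set Plane} {ψ : compactC1}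
    (hψ : tsupport (ψ : Plane → ℝ) ⊆ Ω) (x : Plane) (δ : ℝ) (hB : MemLp
      ((Metric.ball x δ).indicator fun _ => (1 : ℝ)) 2 (volume.restrict Ω)) :
    ∫ v in Metric.ball (0 : Plane) δ, (ψ : Plane → ℝ) (x + v) = inner ℝ hB.toLp (toL2 Ω ψ) := by
  set d : Plane → ℝ := ψ.1
  have e1 : ∫ v in Metric.ball (0 : Plane) δ, d (x + v) = ∫ y in Metric.ball x δ, d y := by
    rw [← integral_indicator Metric.isOpen_ball.measurableSet,
      ← integral_indicator Metric.isOpen_ball.measurableSet,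
      ← integral_add_left_eq_self ((Metric.ball x δ).indicator _) x]
    refine integral_congr_ae (.of_forall fun v => ?_)
    by_cases hv : v ∈ Metric.ball (0 : Plane) δ
    · have : x + v ∈ Metric.ball x δ := by simpa using hv
      simp only [Set.indicator_of_mem hv, Set.indicator_of_mem this]
    · have : x + v ∉ Metric.ball x δ := by simpa using hv
      simp only [Set.indicator_of_notMem hv, Set.indicator_of_notMem this]
  have e2 : ∫ y in Metric.ball x δ, d y =
      ∫ y in Ω, (Metric.ball x δ).indicator (fun _ => (1 : ℝ)) y * d y := by
    rw [setIntegral_eq_integral_of_forall_compl_eq_zero (s := Ω),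
      ← integral_indicator Metric.isOpen_ball.measurableSet]
    · refine integral_congr_ae (.of_forall fun v => ?_)
      by_cases hv : v ∈ Metric.ball x δ
      · simp [hv]
      · simp [hv]
    · intro y hy
      rw [image_eq_zero_of_notMem_tsupport fun h => hy (hψ h), mul_zero]
  rw [e1, e2, L2.inner_def]
  refine integral_congr_ae ?_
  filter_upwards [hB.coeFn_toLp, coeFn_toL2 Ω ψ] with y h1 h2
  rw [h1, h2]
  simp [d, mul_comm]

/-- For fixed `δ` the local integrals tend to zero pointwise and are uniformly bounded, so dominated
convergence applies. The remaining error is at most `δ` times a uniform gradient bound. -/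
theorem tendsto_lintegral_enorm_of_weakTendsto {Ω : Set Plane} (hΩ : IsOpen Ω)
    (hΩb : Bornology.IsBounded Ω) {ψ : ℕ → compactC1}
    (hψ : ∀ n, tsupport (ψ n : Plane → ℝ) ⊆ Ω) {C : ℝ} (h1 : ∀ n, ‖toL2 Ω (ψ n)‖ ≤ C)
    (h2 : ∀ n, ‖gradL2 Ω (ψ n)‖ ≤ C) (hw : WeakTendsto (fun n => toL2 Ω (ψ n)) 0) :
    Tendsto (fun n => ∫⁻ x in Ω, ‖(ψ n : Plane → ℝ) x‖ₑ) atTop (𝓝 0) := by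
  have hvol : volume Ω ≠ ⊤ := hΩb.measure_lt_top.ne
  have hfin : IsFiniteMeasure (volume.restrict Ω) := ⟨by simpa using hvol.lt_top⟩
  have hB : ∀ (x : Plane) (δ : ℝ),
      MemLp ((Metric.ball x δ).indicator fun _ => (1 : ℝ)) 2 (volume.restrict Ω) := fun x δ =>
    (memLp_const (1 : ℝ)).indicator Metric.isOpen_ball.measurableSet
  have havg : ∀ δ : ℝ, Tendsto (fun n => ∫⁻ x in Ω,
      ‖∫ v in Metric.ball (0 : Plane) δ, (ψ n : Plane → ℝ) (x + v)‖ₑ) atTop (𝓝 0) := by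
    intro δ
    have hnorm : ∀ x, ‖(hB x δ).toLp‖ₑ ≤ eLpNorm (fun _ : Plane => (1 : ℝ)) 2
        (volume.restrict Ω) := by
      intro x
      rw [Lp.enorm_toLp]
      exact eLpNorm_indicator_le _
    set L := eLpNorm (fun _ : Plane => (1 : ℝ)) 2 (volume.restrict Ω)
    have hL : L ≠ ⊤ := (memLp_const (1 : ℝ)).2.ne
    have hlim := tendsto_lintegral_of_dominated_convergence (μ := volume.restrict Ω)
      (F := fun n x => ‖∫ v in Metric.ball (0 : Plane) δ, (ψ n : Plane → ℝ) (x + v)‖ₑ)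
      (f := fun _ => 0) (fun _ => L * ENNReal.ofReal C) (fun n => ?_) (fun n => ?_) ?_ ?_
    · simpa using hlim
    · have hc : Continuous (ψ n : Plane → ℝ) := (ψ n).2.1.continuous
      have : StronglyMeasurable fun q : Plane × Plane => (ψ n : Plane → ℝ) (q.1 + q.2) :=
        (by fun_prop : Continuous fun q : Plane × Plane =>
          (ψ n : Plane → ℝ) (q.1 + q.2)).stronglyMeasurable
      exact this.integral_prod_right'.measurable.enorm
    · refine .of_forall fun x => ?_
      simp only
      rw [setIntegral_ball_translate (hψ n) x δ (hB x δ), ← ofReal_norm]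
      calc ENNReal.ofReal ‖inner ℝ (hB x δ).toLp (toL2 Ω (ψ n))‖
          ≤ ENNReal.ofReal (‖(hB x δ).toLp‖ * ‖toL2 Ω (ψ n)‖) :=
            ENNReal.ofReal_le_ofReal (norm_inner_le_norm _ _)
        _ = ‖(hB x δ).toLp‖ₑ * ENNReal.ofReal ‖toL2 Ω (ψ n)‖ := by
            rw [ENNReal.ofReal_mul (norm_nonneg _), ofReal_norm]
        _ ≤ _ := mul_le_mul' (hnorm x) (ENNReal.ofReal_le_ofReal (h1 n))
    · rw [lintegral_const]
      finiteness
    · refine .of_forall fun x => ?_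
      simp only [setIntegral_ball_translate (hψ _) x δ (hB x δ)]
      simpa using (hw (hB x δ).toLp).enorm
  set G : ℝ≥0∞ := ENNReal.ofReal C * volume Ω ^ (1 / 2 : ℝ)
  have hG : G ≠ ⊤ := by finiteness
  have hgrad : ∀ n, ∫⁻ x in Ω, ‖fderiv ℝ (ψ n : Plane → ℝ) x‖ₑ ≤ G := fun n =>
    (lintegral_enorm_fderiv_le (ψ n)).trans (by
      rw [← ofReal_norm]
      exact mul_le_mul_left (ENNReal.ofReal_le_ofReal (h2 n)) _)
  rw [ENNReal.tendsto_nhds_zero]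
  intro η hη
  obtain ⟨δ, hδ, hδG⟩ : ∃ δ : ℝ, 0 < δ ∧ ENNReal.ofReal δ * G ≤ η / 2 := by
    have h0 : Tendsto (fun δ : ℝ => ENNReal.ofReal δ * G) (𝓝[>] 0) (𝓝 0) := by
      have := ENNReal.Tendsto.mul_const (b := G)
        ((ENNReal.continuous_ofReal.tendsto 0).mono_left (nhdsWithin_le_nhds (s := Set.Ioi 0)))
        (Or.inr hG)
      simpa using this
    have := (ENNReal.tendsto_nhds_zero.1 h0 (η / 2) (ENNReal.half_pos hη.ne')).and
      self_mem_nhdsWithin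
    obtain ⟨δ, h, h'⟩ := this.exists
    exact ⟨δ, h', h⟩
  have hV0 : volume (Metric.ball (0 : Plane) δ) ≠ 0 := (Metric.measure_ball_pos _ _ hδ).ne'
  have hVt : volume (Metric.ball (0 : Plane) δ) ≠ ⊤ := measure_ball_lt_top.ne
  filter_upwards [ENNReal.tendsto_nhds_zero.1 (havg δ)
    (volume (Metric.ball (0 : Plane) δ) * (η / 2))
    (pos_iff_ne_zero.2 (mul_ne_zero hV0 (ENNReal.half_pos hη.ne').ne'))] with n hn
  rw [← ENNReal.mul_le_mul_iff_right hV0 hVt]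
  calc _ ≤ _ := volume_ball_mul_lintegral_enorm_le hΩ.measurableSet (hψ n)
    _ ≤ volume (Metric.ball (0 : Plane) δ) * (η / 2) +
        volume (Metric.ball (0 : Plane) δ) * (η / 2) := by
      gcongr
      exact (mul_le_mul_right (hgrad n) _).trans hδG
    _ = _ := by rw [← mul_add, ENNReal.add_halves]

theorem tendsto_lintegral_enorm_fst_of_weakTendsto {Ω : Set Plane} (hΩ : IsOpen Ω)
    (hΩb : Bornology.IsBounded Ω) {x : ℕ → Jet Ω} (hx : ∀ n, x n ∈ sobolevZero Ω) {C : ℝ}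
    (hC : ∀ n, ‖x n‖ ≤ C) (hw : WeakTendsto x 0) :
    Tendsto (fun n => ∫⁻ y in Ω, ‖(x n).fst y‖ₑ) atTop (𝓝 0) := by
  have hpos : ∀ n : ℕ, 0 < 1 / ((n : ℝ) + 1) := fun n => by positivity
  -- Test functions at distance below `1 / (n + 1)` share the weak limit and keep the norms bounded
  -- by `C + 1`.
  choose ψ hψ hψx using fun n => exists_dist_lt_of_mem_sobolevZero (hx n) (hpos n)
  have hsub : Tendsto (fun n => x n - jet Ω (ψ n)) atTop (𝓝 0) :=
    squeeze_zero_norm (fun n => (hψx n).le) tendsto_one_div_add_atTop_nhds_zero_nat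
  have hbd : ∀ n, ‖jet Ω (ψ n)‖ ≤ C + 1 := fun n => by
    have h1 : ‖x n - jet Ω (ψ n)‖ ≤ 1 := (hψx n).le.trans (by
      rw [div_le_one (by positivity)]
      linarith [n.cast_nonneg (α := ℝ)])
    have h2 := norm_sub_le (x n) (x n - jet Ω (ψ n))
    rw [sub_sub_cancel] at h2
    linarith [hC n]
  have hwψ : WeakTendsto (fun n => jet Ω (ψ n)) 0 := by
    simpa using hw.sub (weakTendsto_of_tendsto hsub)
  have hmain := tendsto_lintegral_enorm_of_weakTendsto hΩ hΩb (fun n => (hψ n).2.2)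
    (fun n => (WithLp.norm_fst_le _ (jet Ω (ψ n))).trans (hbd n))
    (fun n => (WithLp.norm_snd_le _ (jet Ω (ψ n))).trans (hbd n))
    (by simpa using hwψ.fst)
  have hsub' : Tendsto (fun n => ‖x n - jet Ω (ψ n)‖ₑ * volume Ω ^ (1 / 2 : ℝ)) atTop (𝓝 0) := by
    have hvol : volume Ω ≠ ⊤ := hΩb.measure_lt_top.ne
    simpa using ENNReal.Tendsto.mul_const hsub.enorm (Or.inr (by finiteness))
  have hadd := hmain.add hsub'
  rw [add_zero] at hadd
  refine tendsto_of_tendsto_of_tendsto_of_le_of_le tendsto_const_nhds hadd (fun _ => zero_le)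
    fun n => ?_
  have hae : ∀ᵐ y ∂volume.restrict Ω, ‖(x n).fst y‖ₑ ≤ ‖(ψ n : Plane → ℝ) y‖ₑ +
      ‖((x n).fst - toL2 Ω (ψ n) : L2 Ω ℝ) y‖ₑ := by
    filter_upwards [Lp.coeFn_sub (x n).fst (toL2 Ω (ψ n)), coeFn_toL2 Ω (ψ n)] with y h1 h2
    rw [h1, Pi.sub_apply, h2]
    refine le_trans (le_of_eq ?_) (enorm_add_le _ _)
    congr 1
    ring
  refine (lintegral_mono_ae hae).trans ?_
  rw [lintegral_add_left ((ψ n).2.1.continuous.measurable.enorm)]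
  gcongr
  refine (lintegral_enorm_le_eLpNorm_two (Lp.aestronglyMeasurable _)).trans ?_
  gcongr
  rw [← Lp.enorm_def]
  have := WithLp.norm_fst_le _ (x n - jet Ω (ψ n))
  exact enorm_le_iff_norm_le.2 this

/-! ### Weak closedness of the constraints -/

theorem HasWeakDivergence.of_weakTendsto {Ω : Set Plane} {σ : ℕ → L2 Ω Plane} {τ : L2 Ω Plane}
    {f : Plane → ℝ} (h : ∀ n, HasWeakDivergence Ω (σ n) f) (hw : WeakTendsto σ τ) :
    HasWeakDivergence Ω τ f := by
  intro ψ hψ hψc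
  have key := hw (gradL2 Ω ⟨ψ, hψ, hψc⟩)
  simp only [inner_gradL2] at key
  refine tendsto_nhds_unique (tendsto_const_nhds.congr fun n => ?_) key.neg
  exact h n ψ hψ hψc

/-- Paired with a fixed vector `e`, each side of the weak gradient identity is a continuous
functional, so weak convergence can be applied to it. -/
theorem exists_inner_eq_setIntegral_smul_gradient {Ω : Set Plane} (ψ : compactC1) (e : Plane) :
    ∃ a : L2 Ω ℝ, ∀ u : L2 Ω ℝ,
      inner ℝ e (∫ x in Ω, u x • gradient (ψ : Plane → ℝ) x) = inner ℝ a u := by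
  have ha := (memLp_gradient_compactC1 ψ Ω).const_inner (𝕜 := ℝ) e
  refine ⟨ha.toLp, fun u => ?_⟩
  have hi : Integrable (fun x => u x • gradient (ψ : Plane → ℝ) x) (volume.restrict Ω) :=
    memLp_one_iff_integrable.1
      ((memLp_gradient_compactC1 ψ Ω).smul (p := 2) (q := 2) (r := 1) (Lp.memLp u))
  rw [← integral_inner hi e, L2.inner_def]
  refine integral_congr_ae ?_
  filter_upwards [ha.coeFn_toLp] with x hx
  rw [hx, inner_smul_right]
  simp

theorem exists_inner_eq_setIntegral_smul {Ω : Set Plane} (ψ : compactC1) (e : Plane) :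
    ∃ b : L2 Ω Plane, ∀ g : L2 Ω Plane,
      inner ℝ e (∫ x in Ω, (ψ : Plane → ℝ) x • g x) = inner ℝ b g := by
  have hb : MemLp (fun x => (ψ : Plane → ℝ) x • e) 2 (volume.restrict Ω) :=
    ((ψ.2.1.continuous.smul continuous_const).memLp_of_hasCompactSupport
      ψ.2.2.smul_right).restrict Ω
  refine ⟨hb.toLp, fun g => ?_⟩
  have hi : Integrable (fun x => (ψ : Plane → ℝ) x • g x) (volume.restrict Ω) :=
    memLp_one_iff_integrable.1
      ((Lp.memLp g).smul (p := 2) (q := 2) (r := 1) (memLp_compactC1 ψ Ω))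
  rw [← integral_inner hi e, L2.inner_def]
  refine integral_congr_ae ?_
  filter_upwards [hb.coeFn_toLp] with x hx
  rw [hx, real_inner_smul_left, inner_smul_right]

theorem HasWeakGradient.of_weakTendsto {Ω : Set Plane} {u : ℕ → L2 Ω ℝ} {g : ℕ → L2 Ω Plane}
    {v : L2 Ω ℝ} {k : L2 Ω Plane} (h : ∀ n, HasWeakGradient Ω (u n) (g n))
    (hu : WeakTendsto u v) (hg : WeakTendsto g k) : HasWeakGradient Ω v k := by
  intro ψ hψ
  refine ext_inner_left ℝ fun e => ?_
  obtain ⟨b, hb⟩ := exists_inner_eq_setIntegral_smul (Ω := Ω) ⟨ψ, hψ.mem_compactC1⟩ e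
  obtain ⟨a, ha⟩ :=
    exists_inner_eq_setIntegral_smul_gradient (Ω := Ω) ⟨ψ, hψ.mem_compactC1⟩ e
  have h1 := hu a
  have h2 := hg b
  simp only [← ha, ← hb] at h1 h2
  rw [inner_neg_right]
  refine tendsto_nhds_unique h1 (h2.neg.congr fun n => ?_)
  rw [h n ψ hψ, inner_neg_right]

/-! ### The constant function 1 and weak closedness of the boundary condition -/

section one

variable (Ω : Set Plane) [IsFiniteMeasure ((volume : Measure Plane).restrict Ω)]

/-- The constant function `1` as an element of `L²(Ω)`. -/
noncomputable def oneL2 : L2 Ω ℝ := (memLp_const (1 : ℝ)).toLp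

theorem coeFn_oneL2 : oneL2 Ω =ᵐ[volume.restrict Ω] fun _ => 1 := MemLp.coeFn_toLp _

variable {Ω}

theorem integral_gradient_eq_zero {ψ : Plane → ℝ} (hψ : ContDiff ℝ 1 ψ)
    (hψc : HasCompactSupport ψ) : ∫ x, gradient ψ x = 0 := by
  refine ext_inner_left ℝ fun e => ?_
  have hg : Integrable (gradient ψ) :=
    (continuous_gradient hψ).integrable_of_hasCompactSupport (hasCompactSupport_gradient hψc)
  rw [inner_zero_right, ← integral_inner hg]
  have hfd : ∀ x, inner ℝ e (gradient ψ x) = fderiv ℝ ψ x e := fun x => by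
    rw [real_inner_comm, gradient, InnerProductSpace.toDual_symm_apply]
  have hi : Integrable fun x => fderiv ℝ ψ x e := by
    simpa only [hfd] using hg.const_inner (𝕜 := ℝ) e
  have := integral_mul_fderiv_eq_neg_fderiv_mul_of_integrable (μ := (volume : Measure Plane))
    (f := fun _ => (1 : ℝ)) (g := ψ) (v := e) (by simp) (by simpa using hi)
    (by simpa using hψ.continuous.integrable_of_hasCompactSupport hψc)
    (fun _ _ => differentiableAt_const _) (fun x _ => hψ.differentiable one_ne_zero x)
  simpa [hfd] using this

theorem hasWeakGradient_oneL2 : HasWeakGradient Ω (oneL2 Ω) 0 := by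
  intro ψ hψ
  have h1 : ∫ x in Ω, oneL2 Ω x • gradient ψ x = ∫ x in Ω, gradient ψ x :=
    integral_congr_ae (by filter_upwards [coeFn_oneL2 Ω] with x hx; rw [hx, one_smul])
  have h2 : ∫ x in Ω, ψ x • (0 : L2 Ω Plane) x = 0 :=
    integral_eq_zero_of_ae (by
      filter_upwards [Lp.coeFn_zero Plane 2 (volume.restrict Ω)] with x hx
      exact (congrArg (ψ x • ·) hx).trans (smul_zero _))
  rw [h1, h2, neg_zero, setIntegral_eq_integral_of_forall_compl_eq_zero,
    integral_gradient_eq_zero hψ.mem_compactC1.1 hψ.2.1]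
  intro x hx
  have : fderiv ℝ ψ x = 0 :=
    image_eq_zero_of_notMem_tsupport fun h => hx (hψ.2.2 (tsupport_fderiv_subset ℝ h))
  rw [gradient, this, map_zero]

variable (Ω) in
/-- The constant function `1` in `W^{1,2}(Ω)`. -/
noncomputable def W12.one : W12 Ω := ⟨oneL2 Ω, 0, hasWeakGradient_oneL2⟩

/-- The pair `(u - 1, ∇u)`. -/
noncomputable def W12.subOne (u : W12 Ω) : Jet Ω := WithLp.toLp 2 (u.val - oneL2 Ω, u.grad)

theorem W12.subOne_fst (u : W12 Ω) : u.subOne.fst = u.val - oneL2 Ω := rfl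

theorem W12.subOne_snd (u : W12 Ω) : u.subOne.snd = u.grad := rfl

theorem W12.coeFn_subOne_fst (u : W12 Ω) :
    u.subOne.fst =ᵐ[volume.restrict Ω] fun x => u.val x - 1 := by
  filter_upwards [Lp.coeFn_sub u.val (oneL2 Ω), coeFn_oneL2 Ω] with x h1 h2
  rw [subOne_fst, h1, Pi.sub_apply, h2]

theorem W12.tendsto_jet_subOne_iff (u : W12 Ω) (ψ : ℕ → compactC1) :
    Tendsto (fun k => jet Ω (ψ k)) atTop (𝓝 u.subOne) ↔
      Tendsto (fun k => eLpNorm (fun x => (u.val x - 1) - (ψ k : Plane → ℝ) x) 2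
        (volume.restrict Ω)) atTop (𝓝 0) ∧
      Tendsto (fun k => eLpNorm (fun x => u.grad x - gradient (ψ k : Plane → ℝ) x) 2
        (volume.restrict Ω)) atTop (𝓝 0) := by
  have h1 : Tendsto (fun k => jet Ω (ψ k)) atTop (𝓝 u.subOne) ↔
      Tendsto (fun k => toL2 Ω (ψ k)) atTop (𝓝 u.subOne.fst) ∧
        Tendsto (fun k => gradL2 Ω (ψ k)) atTop (𝓝 u.subOne.snd) := by
    rw [(WithLp.homeomorphProd 2 (L2 Ω ℝ) (L2 Ω Plane)).isInducing.tendsto_nhds_iff,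
      Prod.tendsto_iff]
    rfl
  rw [h1, Lp.tendsto_Lp_iff_tendsto_eLpNorm', Lp.tendsto_Lp_iff_tendsto_eLpNorm']
  refine and_congr (tendsto_congr fun k => ?_) (tendsto_congr fun k => ?_)
  · rw [eLpNorm_sub_comm]
    refine eLpNorm_congr_ae ?_
    filter_upwards [u.coeFn_subOne_fst, coeFn_toL2 Ω (ψ k)] with x h1 h2
    rw [Pi.sub_apply, h1, h2]
  · rw [eLpNorm_sub_comm]
    refine eLpNorm_congr_ae ?_
    filter_upwards [coeFn_gradL2 Ω (ψ k)] with x h2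
    rw [Pi.sub_apply, h2, W12.subOne_snd]

/-- Recasts the boundary condition as membership in a closed subspace, where weak closedness is
available. -/
theorem W12.eqOneOnBoundary_iff (u : W12 Ω) :
    u.EqOneOnBoundary ↔ u.subOne ∈ sobolevZero Ω := by
  constructor
  · rintro ⟨ψ, hψ, h⟩
    refine mem_closure_of_tendsto
      ((u.tendsto_jet_subOne_iff fun k => ⟨ψ k, (hψ k).mem_compactC1⟩).2 h)
      (.of_forall fun k => ⟨⟨ψ k, (hψ k).mem_compactC1⟩, hψ k, rfl⟩)
  · intro h
    obtain ⟨ψ, hψ, hlim⟩ := exists_seq_of_mem_sobolevZero h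
    exact ⟨fun k => ψ k, hψ, (u.tendsto_jet_subOne_iff ψ).1 hlim⟩

theorem W12.one_eqOneOnBoundary : (W12.one Ω).EqOneOnBoundary := by
  rw [W12.eqOneOnBoundary_iff]
  have : (W12.one Ω).subOne = 0 := by
    simp [W12.subOne, W12.one]
  rw [this]
  exact zero_mem _

/-- Weak limits of sequences in `1 + W₀^{1,2}(Ω)` belong to `1 + W₀^{1,2}(Ω)`. -/
theorem W12.exists_of_weakTendsto {u : ℕ → W12 Ω} (hu : ∀ n, (u n).EqOneOnBoundary)
    {x : Jet Ω} (hw : WeakTendsto (fun n => (u n).subOne) x) :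
    ∃ v : W12 Ω, v.EqOneOnBoundary ∧ v.subOne = x := by
  have hg : HasWeakGradient Ω (x.fst + oneL2 Ω) x.snd := by
    refine HasWeakGradient.of_weakTendsto (fun n => (u n).isWeakGradient) (fun v => ?_) hw.snd
    rw [inner_add_right]
    refine ((hw.fst v).add_const _).congr fun n => ?_
    rw [← inner_add_right]
    simp only [subOne_fst, sub_add_cancel]
  refine ⟨⟨x.fst + oneL2 Ω, x.snd, hg⟩, ?_, ?_⟩
  · rw [eqOneOnBoundary_iff]
    have : (⟨x.fst + oneL2 Ω, x.snd, hg⟩ : W12 Ω).subOne = x := by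
      simp [subOne]
      rfl
    rw [this]
    exact hw.mem_topologicalClosure fun n => (eqOneOnBoundary_iff _).1 (hu n)
  · simp [subOne]
    rfl

end one

/-! ### The integrand `omega` -/

/-- The coefficient of the quadratic regularization in `omega`. -/
noncomputable def regCoeff (ε p : ℝ) (α₀ : ℝ≥0∞) : ℝ := if α₀ = ⊤ then 0 else ε ^ p

/-- The slope of `omega` (without regularization) at `s`, divided by `s`. -/
noncomputable def slopeCoeff (α₀ : ℝ≥0∞) (g s : ℝ) : ℝ :=
  if α₀ = ⊤ ∨ s ≤ α₀.toReal / g then g else α₀.toReal / s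

section omega

variable {ε p : ℝ} {α₀ : ℝ≥0∞} {g s : ℝ}

theorem regCoeff_nonneg (hε : 0 < ε) : 0 ≤ regCoeff ε p α₀ := by
  unfold regCoeff
  split_ifs <;> positivity

theorem pos_of_not_le_div (hg : 0 < g) (h : ¬ s ≤ α₀.toReal / g) : 0 < s :=
  (div_nonneg ENNReal.toReal_nonneg hg.le).trans_lt (not_le.1 h)

theorem slopeCoeff_nonneg (hg : 0 < g) (hs : 0 ≤ s) : 0 ≤ slopeCoeff α₀ g s := by
  unfold slopeCoeff
  split_ifs <;> positivity

theorem slopeCoeff_le (hg : 0 < g) : slopeCoeff α₀ g s ≤ g := by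
  unfold slopeCoeff
  split_ifs with h
  · exact le_rfl
  · rw [not_or] at h
    rw [div_le_iff₀ (pos_of_not_le_div hg h.2)]
    have := (div_lt_iff₀ hg).1 (not_le.1 h.2)
    linarith

theorem slopeCoeff_mul_le (hg : 0 < g) (hα₀ : α₀ ≠ ⊤) : slopeCoeff α₀ g s * s ≤ α₀.toReal := by
  unfold slopeCoeff
  split_ifs with h
  · have := (le_div_iff₀ hg).1 (h.resolve_left hα₀)
    linarith
  · rw [not_or] at h
    rw [div_mul_cancel₀ _ (pos_of_not_le_div hg h.2).ne']

theorem measurable_slopeCoeff : Measurable fun q : ℝ × ℝ => slopeCoeff α₀ q.1 q.2 := by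
  unfold slopeCoeff
  refine Measurable.ite ?_ measurable_fst (by fun_prop)
  exact (MeasurableSet.const (α₀ = ⊤)).union
    (measurableSet_le measurable_snd (measurable_const.div measurable_fst))

/-- The equality case of `le_omega`, at `x = slopeCoeff α₀ g s * s` and `r = t = s`. -/
theorem omega_eq (hg : 0 < g) : omega ε p α₀ g s =
    slopeCoeff α₀ g s * s ^ 2 - (slopeCoeff α₀ g s * s) ^ 2 / (2 * g) +
      regCoeff ε p α₀ * s ^ 2 := by
  unfold omega slopeCoeff regCoeff
  by_cases h : α₀ = ⊤
  · simp only [h, if_true, true_or]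
    field_simp
    ring
  · by_cases h' : s ≤ α₀.toReal / g
    · simp only [h, h', if_true, if_false, or_true]
      field_simp
      ring
    · have hs := pos_of_not_le_div hg h'
      simp only [h, h', if_false, or_self]
      field_simp

/-- Fenchel–Young: the main part of `omega` is conjugate to `x² / (2g)` restricted to slopes `x ≤
α₀`. The same slope is allowed for every weight `g`, which is what permits comparing different
weights. -/
theorem le_omega (hε : 0 < ε) {x t r : ℝ} (hg : 0 < g) (hx : α₀ ≠ ⊤ → x ≤ α₀.toReal) :
    x * t - x ^ 2 / (2 * g) + regCoeff ε p α₀ * (2 * r * t - r ^ 2) ≤ omega ε p α₀ g t := by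
  have hquad : x * t - x ^ 2 / (2 * g) ≤ g * (t ^ 2 / 2) := by
    have : g * (t ^ 2 / 2) - (x * t - x ^ 2 / (2 * g)) = (g * t - x) ^ 2 / (2 * g) := by
      field_simp
      ring
    have h2 : 0 ≤ (g * t - x) ^ 2 / (2 * g) := by positivity
    linarith
  unfold omega regCoeff
  by_cases h : α₀ = ⊤
  · simpa [h] using hquad
  · have hreg : ε ^ p * (2 * r * t - r ^ 2) ≤ ε ^ p * t ^ 2 := by
      have : 0 ≤ ε ^ p := by positivity
      gcongr
      nlinarith [sq_nonneg (t - r)]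
    simp only [h, if_false]
    by_cases h' : t ≤ α₀.toReal / g
    · simp only [h', if_true]
      linarith
    · simp only [h', if_false]
      have hxa := hx h
      have hta := (div_lt_iff₀ hg).1 (not_le.1 h')
      have e : α₀.toReal * (t - α₀.toReal / (2 * g)) - (x * t - x ^ 2 / (2 * g)) =
          (α₀.toReal - x) * (2 * (t * g) - (α₀.toReal + x)) / (2 * g) := by
        field_simp
        ring
      have : 0 ≤ (α₀.toReal - x) * (2 * (t * g) - (α₀.toReal + x)) / (2 * g) :=
        div_nonneg (mul_nonneg (by linarith) (by linarith)) (by positivity)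
      linarith

/-- The slope is taken at `σ` with weight `g`, but the bound is for another weight `g'`: in the
application `g` is the limit weight and `g'` that of the sequence. -/
theorem le_omega_of_inner (hε : 0 < ε) (hg : 0 < g) {g' : ℝ} (hg' : 0 < g') (σ τ : Plane) :
    inner ℝ ((slopeCoeff α₀ g ‖σ‖ + 2 * regCoeff ε p α₀) • σ) τ -
      (slopeCoeff α₀ g ‖σ‖ * ‖σ‖) ^ 2 / (2 * g') - regCoeff ε p α₀ * ‖σ‖ ^ 2 ≤
      omega ε p α₀ g' ‖τ‖ := by
  have h := le_omega (p := p) (α₀ := α₀) (x := slopeCoeff α₀ g ‖σ‖ * ‖σ‖) (t := ‖τ‖) (r := ‖σ‖) hε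
    hg' (fun h => slopeCoeff_mul_le (s := ‖σ‖) hg h)
  have hk : 0 ≤ slopeCoeff α₀ g ‖σ‖ + 2 * regCoeff ε p α₀ :=
    add_nonneg (slopeCoeff_nonneg hg (norm_nonneg _))
      (mul_nonneg zero_le_two (regCoeff_nonneg hε))
  have hin := mul_le_mul_of_nonneg_left (real_inner_le_norm σ τ) hk
  rw [real_inner_smul_left]
  nlinarith

theorem omega_nonneg (hε : 0 < ε) (hg : 0 < g) : 0 ≤ omega ε p α₀ g s := by
  simpa using le_omega (p := p) (α₀ := α₀) (x := 0) (t := s) (r := 0) hε hg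
    (fun _ => ENNReal.toReal_nonneg)

theorem omega_le (hε : 0 < ε) (hg : 0 < g) :
    omega ε p α₀ g s ≤ (g + ε ^ p) * s ^ 2 := by
  have hk := slopeCoeff_le (α₀ := α₀) (s := s) hg
  have hr : regCoeff ε p α₀ ≤ ε ^ p := by
    unfold regCoeff
    split_ifs
    · positivity
    · exact le_rfl
  rw [omega_eq hg]
  have h1 : 0 ≤ (slopeCoeff α₀ g s * s) ^ 2 / (2 * g) := by positivity
  have h2 := mul_le_mul_of_nonneg_right hk (sq_nonneg s)
  have h3 := mul_le_mul_of_nonneg_right hr (sq_nonneg s)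
  linarith

/-- Coercivity: for `α₀ = ⊤` the weight gives it, for finite `α₀` the growth of the main part is
only linear and the regularization does. -/
theorem mul_sq_le_omega {c : ℝ} (hc : 0 < c) (hcg : c ≤ g) :
    min (c / 2) (ε ^ p) * s ^ 2 ≤ omega ε p α₀ g s := by
  have hg := hc.trans_le hcg
  unfold omega
  split_ifs with h h'
  · calc _ ≤ c / 2 * s ^ 2 := by gcongr; exact min_le_left _ _
      _ ≤ g / 2 * s ^ 2 := by gcongr
      _ = _ := by ring
  · have : 0 ≤ g * (s ^ 2 / 2) := by positivity
    have := mul_le_mul_of_nonneg_right (min_le_right (c / 2) (ε ^ p)) (sq_nonneg s)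
    linarith
  · have hta := (div_lt_iff₀ hg).1 (not_le.1 h')
    have h0 : 0 ≤ α₀.toReal := ENNReal.toReal_nonneg
    have : 0 ≤ α₀.toReal * (s - α₀.toReal / (2 * g)) := by
      refine mul_nonneg h0 ?_
      rw [sub_nonneg, div_le_iff₀ (by positivity)]
      linarith
    have := mul_le_mul_of_nonneg_right (min_le_right (c / 2) (ε ^ p)) (sq_nonneg s)
    linarith

end omega

/-! ### Lower semicontinuity -/

theorem ofReal_integral_le_lintegral_ofReal {α : Type*} [MeasurableSpace α] {μ : Measure α}
    {L : α → ℝ} (hL : Integrable L μ) :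
    ENNReal.ofReal (∫ x, L x ∂μ) ≤ ∫⁻ x, ENNReal.ofReal (L x) ∂μ := by
  rw [integral_eq_lintegral_pos_part_sub_lintegral_neg_part hL]
  refine (ENNReal.ofReal_le_ofReal (sub_le_self _ ENNReal.toReal_nonneg)).trans ?_
  exact ENNReal.ofReal_toReal_le

theorem lintegral_le_liminf_of_tendsto_integral {α : Type*} [MeasurableSpace α] {μ : Measure α}
    {F : ℕ → α → ℝ≥0∞} {L : ℕ → α → ℝ} {L' : α → ℝ}
    (hLF : ∀ n, ∀ᵐ x ∂μ, ENNReal.ofReal (L n x) ≤ F n x) (hL : ∀ n, Integrable (L n) μ)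
    (hL' : Integrable L' μ) (h0 : ∀ᵐ x ∂μ, 0 ≤ L' x)
    (hlim : Tendsto (fun n => ∫ x, L n x ∂μ) atTop (𝓝 (∫ x, L' x ∂μ))) :
    ∫⁻ x, ENNReal.ofReal (L' x) ∂μ ≤ liminf (fun n => ∫⁻ x, F n x ∂μ) atTop := by
  rw [← ofReal_integral_eq_lintegral_ofReal hL' h0,
    ← ((ENNReal.continuous_ofReal.tendsto _).comp hlim).liminf_eq]
  exact liminf_le_liminf (.of_forall fun n =>
    (ofReal_integral_le_lintegral_ofReal (hL n)).trans (lintegral_mono_ae (hLF n)))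

theorem norm_sq_eq_integral {Ω : Set Plane} {F : Type} [NormedAddCommGroup F]
    [InnerProductSpace ℝ F] (u : L2 Ω F) : ‖u‖ ^ 2 = ∫ x in Ω, ‖u x‖ ^ 2 := by
  rw [← real_inner_self_eq_norm_sq, L2.inner_def]
  simp only [real_inner_self_eq_norm_sq]

theorem integrable_norm_sq {Ω : Set Plane} {F : Type} [NormedAddCommGroup F]
    [InnerProductSpace ℝ F] (u : L2 Ω F) :
    Integrable (fun x => ‖u x‖ ^ 2) (volume.restrict Ω) := by
  simpa only [real_inner_self_eq_norm_sq] using L2.integrable_inner (𝕜 := ℝ) u u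

theorem lintegral_le_of_forall_setLIntegral_le {α : Type*} [MeasurableSpace α]
    {μ : Measure α} {F : α → ℝ≥0∞} {g : α → ℝ} {b : ℝ≥0∞}
    (h : ∀ m : ℕ, ∫⁻ x in {x | g x ≤ m}, F x ∂μ ≤ b) : ∫⁻ x, F x ∂μ ≤ b := by
  have hU : (⋃ m : ℕ, {x | g x ≤ m}) = Set.univ :=
    Set.eq_univ_of_forall fun x => Set.mem_iUnion.2 (exists_nat_ge (g x))
  rw [← setLIntegral_univ, ← hU, setLIntegral_iUnion_of_directed]
  · exact iSup_le h
  · exact (monotone_nat_of_le_succ fun m x (hx : g x ≤ m) =>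
      hx.trans (by exact_mod_cast m.le_succ)).directed_le

theorem lintegral_omega_le_liminf {Ω : Set Plane} {ε p : ℝ} {α₀ : ℝ≥0∞} (hε : 0 < ε)
    {g : ℕ → Plane → ℝ} {g' : Plane → ℝ} {c : ℝ} (hc : 0 < c) (hg : ∀ n, Measurable (g n))
    (hg' : Measurable g') (hcg : ∀ n x, c ≤ g n x) (hcg' : ∀ x, c ≤ g' x)
    (hlim : ∀ᵐ x ∂volume.restrict Ω, Tendsto (fun n => g n x) atTop (𝓝 (g' x)))
    {σ : ℕ → L2 Ω Plane} {τ : L2 Ω Plane} (hw : WeakTendsto σ τ) :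
    ∫⁻ x in Ω, ENNReal.ofReal (omega ε p α₀ (g' x) ‖τ x‖) ≤
      liminf (fun n => ∫⁻ x in Ω, ENNReal.ofReal (omega ε p α₀ (g n x) ‖σ n x‖)) atTop := by
  -- The slope coefficient at the limit is bounded only by `g'`, which may be unbounded; truncating
  -- to `g' ≤ m` keeps the test field in `L²`.
  refine lintegral_le_of_forall_setLIntegral_le (g := g') fun m => ?_
  set A := {x | g' x ≤ m}
  have mA : MeasurableSet A := measurableSet_le hg' measurable_const
  set q := regCoeff ε p α₀
  have hq : 0 ≤ q := regCoeff_nonneg hε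
  set k : Plane → ℝ := fun x => slopeCoeff α₀ (g' x) ‖τ x‖
  have hτm : Measurable τ := (Lp.stronglyMeasurable τ).measurable
  have hk : Measurable k := measurable_slopeCoeff.comp (hg'.prodMk hτm.norm)
  have hk0 : ∀ x, 0 ≤ k x := fun x => slopeCoeff_nonneg (hc.trans_le (hcg' x)) (norm_nonneg _)
  have hkg : ∀ x, k x ≤ g' x := fun x => slopeCoeff_le (hc.trans_le (hcg' x))
  have hη : MemLp (fun x => A.indicator (fun x => k x + 2 * q) x • τ x) 2 (volume.restrict Ω) := by
    refine (Lp.memLp τ).of_le_mul (c := m + 2 * q) ?_ (.of_forall fun x => ?_)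
    · exact (((hk.add_const _).indicator mA).smul hτm).aestronglyMeasurable
    · rw [norm_smul]
      gcongr
      by_cases hx : x ∈ A
      · rw [Set.indicator_of_mem hx, Real.norm_of_nonneg (by linarith [hk0 x])]
        linarith [hkg x, show g' x ≤ m from hx]
      · rw [Set.indicator_of_notMem hx, norm_zero]
        positivity
  have hηlim := hw hη.toLp
  have hηint : ∀ u : L2 Ω Plane, inner ℝ hη.toLp u =
      ∫ x in Ω, A.indicator (fun x => inner ℝ ((k x + 2 * q) • τ x) (u x)) x := by
    intro u
    rw [L2.inner_def]
    refine integral_congr_ae ?_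
    filter_upwards [hη.coeFn_toLp] with x hx
    rw [hx]
    by_cases hxA : x ∈ A <;> simp [hxA]
  have hηI : ∀ u : L2 Ω Plane, Integrable
      (A.indicator (fun x => inner ℝ ((k x + 2 * q) • τ x) (u x))) (volume.restrict Ω) := by
    intro u
    refine (L2.integrable_inner (𝕜 := ℝ) hη.toLp u).congr ?_
    filter_upwards [hη.coeFn_toLp] with x hx
    rw [hx]
    by_cases hxA : x ∈ A <;> simp [hxA]
  simp only [hηint] at hηlim
  -- `R f` is the part of the affine minorant free of `σ n`. It involves the weight only through `1
  -- / f ≤ 1 / c`, so dominated convergence applies to it.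
  set R : (Plane → ℝ) → Plane → ℝ := fun f =>
    A.indicator fun x => (k x * ‖τ x‖) ^ 2 / (2 * f x) + q * ‖τ x‖ ^ 2
  have hRm : ∀ f : Plane → ℝ, Measurable f → Measurable (R f) := fun f hf =>
    Measurable.indicator (by fun_prop) mA
  have hτ2 := integrable_norm_sq τ
  have hRb : ∀ f : Plane → ℝ, (∀ x, c ≤ f x) → ∀ x,
      ‖R f x‖ ≤ ((m : ℝ) ^ 2 / (2 * c) + q) * ‖τ x‖ ^ 2 := by
    intro f hf x
    have hfx := hc.trans_le (hf x)
    by_cases hx : x ∈ A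
    · simp only [R, Set.indicator_of_mem hx]
      rw [Real.norm_of_nonneg (by positivity), add_mul, mul_pow, mul_div_right_comm]
      have hkm : k x ≤ m := (hkg x).trans hx
      have := hk0 x
      gcongr
      exact hf x
    · simp only [R, Set.indicator_of_notMem hx, norm_zero]
      positivity
  have hRI : ∀ f : Plane → ℝ, Measurable f → (∀ x, c ≤ f x) →
      Integrable (R f) (volume.restrict Ω) := fun f hf hcf =>
    (hτ2.const_mul _).mono' (hRm f hf).aestronglyMeasurable (.of_forall (hRb f hcf))
  have hRlim : Tendsto (fun n => ∫ x in Ω, R (g n) x) atTop (𝓝 (∫ x in Ω, R g' x)) := by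
    refine tendsto_integral_of_dominated_convergence _
      (fun n => (hRm _ (hg n)).aestronglyMeasurable) (hτ2.const_mul _)
      (fun n => .of_forall (hRb _ (hcg n))) ?_
    filter_upwards [hlim] with x hx
    by_cases hxA : x ∈ A
    · simp only [R, Set.indicator_of_mem hxA]
      refine Tendsto.add_const _ (tendsto_const_nhds.div (hx.const_mul 2) ?_)
      have := hc.trans_le (hcg' x)
      positivity
    · simp only [R, Set.indicator_of_notMem hxA]
      exact tendsto_const_nhds
  have hdiff : ∀ u : L2 Ω Plane, ∀ f : Plane → ℝ, Measurable f → (∀ x, c ≤ f x) →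
      ∫ x in Ω, (A.indicator (fun x => inner ℝ ((k x + 2 * q) • τ x) (u x)) x - R f x) =
      (∫ x in Ω, A.indicator (fun x => inner ℝ ((k x + 2 * q) • τ x) (u x)) x) -
        ∫ x in Ω, R f x := fun u f hf hcf => integral_sub (hηI u) (hRI f hf hcf)
  -- At the limit the minorant touches the integrand.
  have hL' : ∀ x, A.indicator (fun x => inner ℝ ((k x + 2 * q) • τ x) (τ x)) x - R g' x =
      A.indicator (fun x => omega ε p α₀ (g' x) ‖τ x‖) x := by
    intro x
    by_cases hxA : x ∈ A
    · simp only [R, Set.indicator_of_mem hxA]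
      rw [omega_eq (hc.trans_le (hcg' x)), real_inner_smul_left, real_inner_self_eq_norm_sq]
      ring
    · simp [R, hxA]
  have hfinal := lintegral_le_liminf_of_tendsto_integral
    (F := fun n x => ENNReal.ofReal (omega ε p α₀ (g n x) ‖σ n x‖))
    (L := fun n x => A.indicator (fun x => inner ℝ ((k x + 2 * q) • τ x) (σ n x)) x - R (g n) x)
    (L' := fun x => A.indicator (fun x => inner ℝ ((k x + 2 * q) • τ x) (τ x)) x - R g' x)
    (μ := volume.restrict Ω) (fun n => .of_forall fun x => ?_)
    (fun n => (hηI _).sub (hRI _ (hg n) (hcg n))) ((hηI _).sub (hRI _ hg' hcg'))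
    (.of_forall fun x => ?_) ?_
  · refine le_trans (le_of_eq ?_) hfinal
    rw [← lintegral_indicator mA]
    refine lintegral_congr fun x => ?_
    rw [hL' x]
    by_cases hxA : x ∈ A <;> simp [hxA]
  · refine ENNReal.ofReal_le_ofReal ?_
    by_cases hxA : x ∈ A
    · simp only [R, Set.indicator_of_mem hxA]
      have := le_omega_of_inner (p := p) (α₀ := α₀) hε (hc.trans_le (hcg' x))
        (hc.trans_le (hcg n x)) (τ x) (σ n x)
      linarith
    · simp only [R, Set.indicator_of_notMem hxA, sub_zero]
      exact omega_nonneg hε (hc.trans_le (hcg n x))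
  · rw [hL' x]
    exact Set.indicator_nonneg (fun x _ => omega_nonneg hε (hc.trans_le (hcg' x))) x
  · rw [hdiff τ g' hg' hcg']
    exact (hηlim.sub hRlim).congr fun n => (hdiff (σ n) (g n) (hg n) (hcg n)).symm

section LEnergy

variable {Ω : Set Plane} [IsFiniteMeasure ((volume : Measure Plane).restrict Ω)] {ε : ℝ}

theorem LEnergy_eq (hε : 0 < ε) (u : W12 Ω) :
    LEnergy ε u = ENNReal.ofReal ((ε * ‖u.subOne.snd‖ ^ 2 + ‖u.subOne.fst‖ ^ 2 / ε) / 2) := by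
  have h1 := integrable_norm_sq u.subOne.snd
  have h2 := integrable_norm_sq u.subOne.fst
  rw [norm_sq_eq_integral u.subOne.snd, norm_sq_eq_integral u.subOne.fst, ← integral_const_mul,
    ← integral_div, ← integral_add (h1.const_mul ε) (h2.div_const ε), ← integral_div,
    ofReal_integral_eq_lintegral_ofReal (by
      exact ((h1.const_mul ε).add (h2.div_const ε)).div_const 2)]
  · refine lintegral_congr_ae ?_
    filter_upwards [u.coeFn_subOne_fst] with x hx
    rw [hx, Real.norm_eq_abs, sq_abs]
    rfl
  · exact .of_forall fun x => by simp only [Pi.zero_apply]; positivity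

/-- The energy is a convex quadratic in the jet, bounded below by its tangent `2⟪a, b⟫ - ‖a‖² ≤
‖b‖²` at the limit. -/
theorem LEnergy_le_liminf (hε : 0 < ε) {u : ℕ → W12 Ω} {v : W12 Ω}
    (hw : WeakTendsto (fun n => (u n).subOne) v.subOne) :
    LEnergy ε v ≤ liminf (fun n => LEnergy ε (u n)) atTop := by
  simp only [LEnergy_eq hε]
  have hlim : Tendsto (fun n => ENNReal.ofReal
      ((ε * (2 * inner ℝ v.subOne.snd (u n).subOne.snd - ‖v.subOne.snd‖ ^ 2) +
        (2 * inner ℝ v.subOne.fst (u n).subOne.fst - ‖v.subOne.fst‖ ^ 2) / ε) / 2)) atTop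
      (𝓝 (ENNReal.ofReal ((ε * ‖v.subOne.snd‖ ^ 2 + ‖v.subOne.fst‖ ^ 2 / ε) / 2))) := by
    refine (ENNReal.continuous_ofReal.tendsto _).comp ?_
    have h1 := ((hw.snd v.subOne.snd).const_mul 2).sub_const (‖v.subOne.snd‖ ^ 2)
    have h2 := ((hw.fst v.subOne.fst).const_mul 2).sub_const (‖v.subOne.fst‖ ^ 2)
    rw [real_inner_self_eq_norm_sq, two_mul, add_sub_cancel_right] at h1 h2
    exact ((h1.const_mul ε).add (h2.div_const ε)).div_const 2
  rw [← hlim.liminf_eq]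
  refine liminf_le_liminf (.of_forall fun n => ENNReal.ofReal_le_ofReal ?_)
  have key : ∀ {H : Type} [NormedAddCommGroup H] [InnerProductSpace ℝ H] (a b : H),
      2 * inner ℝ a b - ‖a‖ ^ 2 ≤ ‖b‖ ^ 2 := by
    intro H _ _ a b
    have := norm_sub_sq_real a b
    nlinarith [sq_nonneg ‖a - b‖]
  gcongr
  · exact key _ _
  · exact key _ _

end LEnergy

/-! ### The weight `gam` -/

section gam

variable {Ω : Set Plane} {N : ℕ} {α β : Fin N → ℝ} {ε : ℝ}

theorem measurable_gam (φ : Fin N → W12 Ω) : Measurable (gam α β ε φ) := by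
  refine Measurable.iInf fun i => ?_
  have := (Lp.stronglyMeasurable (φ i).val).measurable
  fun_prop

theorem exists_pos_le_gam [Nonempty (Fin N)] (hα : ∀ i, 0 < α i) (hβ : ∀ i, 0 < β i)
    (hε : 0 < ε) : ∃ c > 0, ∀ (φ : Fin N → W12 Ω) x, c ≤ gam α β ε φ x := by
  obtain ⟨j, hj⟩ := Finite.exists_min fun i => α i ^ 2 * ε ^ 2 / β i
  have hαj := hα j
  have hβj := hβ j
  exact ⟨_, by positivity, fun φ x => le_ciInf fun i =>
    (hj i).trans (le_add_of_nonneg_left (sq_nonneg _))⟩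

theorem tendsto_gam {φ : ℕ → Fin N → W12 Ω} {χ : Fin N → W12 Ω} [Nonempty (Fin N)] {x : Plane}
    (h : ∀ i, Tendsto (fun n => (φ n i).val x) atTop (𝓝 ((χ i).val x))) :
    Tendsto (fun n => gam α β ε (φ n) x) atTop (𝓝 (gam α β ε χ x)) := by
  simp only [gam, ← Finset.inf'_univ_eq_ciInf]
  exact Tendsto.finset_inf'_nhds_apply _ fun i _ => ((h i).pow 2).add_const _

end gam

/-! ### The direct method -/

/-- Fatou's lemma for the counting measure. -/
theorem sum_liminf_le_liminf_sum {ι : Type*} [Fintype ι] (f : ℕ → ι → ℝ≥0∞) :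
    ∑ i, liminf (fun n => f n i) atTop ≤ liminf (fun n => ∑ i, f n i) atTop := by
  let _ : MeasurableSpace ι := ⊤
  have := lintegral_liminf_le (u := atTop) (μ := (Measure.count : Measure ι)) (f := f)
    fun n => measurable_from_top
  simpa only [lintegral_count, tsum_fintype] using this

theorem exists_subseq_forall_tendsto_ae {α ι : Type*} [Fintype ι] [MeasurableSpace α]
    {μ : Measure α} {f : ℕ → ι → α → ℝ} (hf : ∀ n i, Measurable (f n i))
    (h : ∀ i, Tendsto (fun n => ∫⁻ x, ‖f n i x‖ₑ ∂μ) atTop (𝓝 0)) :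
    ∃ φ : ℕ → ℕ, StrictMono φ ∧
      ∀ᵐ x ∂μ, ∀ i, Tendsto (fun n => f (φ n) i x) atTop (𝓝 0) := by
  have hm : ∀ n, Measurable fun x => ∑ i, ‖f n i x‖ := fun n =>
    Finset.measurable_sum _ fun i _ => (hf n i).norm
  have hsum : Tendsto (fun n => eLpNorm ((fun x => ∑ i, ‖f n i x‖) - fun _ => (0 : ℝ)) 1 μ)
      atTop (𝓝 0) := by
    have h1 : ∀ n, eLpNorm ((fun x => ∑ i, ‖f n i x‖) - fun _ => (0 : ℝ)) 1 μ =
        ∑ i, ∫⁻ x, ‖f n i x‖ₑ ∂μ := by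
      intro n
      rw [eLpNorm_one_eq_lintegral_enorm, ← lintegral_finsetSum _ fun i _ => (hf n i).enorm]
      refine lintegral_congr fun x => ?_
      simp only [Pi.sub_apply, sub_zero]
      rw [Real.enorm_eq_ofReal (Finset.sum_nonneg fun i _ => norm_nonneg _),
        ENNReal.ofReal_sum_of_nonneg fun i _ => norm_nonneg _]
      simp only [ofReal_norm]
    simp only [h1]
    simpa using tendsto_finsetSum Finset.univ fun i _ => h i
  obtain ⟨φ, hφ, hae⟩ := (tendstoInMeasure_of_tendsto_eLpNorm one_ne_zero
    (fun n => (hm n).aestronglyMeasurable) aestronglyMeasurable_const hsum).exists_seq_tendsto_ae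
  refine ⟨φ, hφ, hae.mono fun x hx i => ?_⟩
  refine squeeze_zero_norm (fun n => ?_) hx
  exact Finset.single_le_sum (f := fun i => ‖f (φ n) i x‖) (fun i _ => norm_nonneg _)
    (Finset.mem_univ i)

section direct

variable {Ω : Set Plane} {N : ℕ} {α₀ : ℝ≥0∞} {α β : Fin N → ℝ} {ε p : ℝ}

theorem lintegral_omega_le_energy (w : L2 Ω Plane × (Fin N → W12 Ω)) :
    ∫⁻ x in Ω, ENNReal.ofReal (omega ε p α₀ (gam α β ε w.2 x / ε) ‖w.1 x‖) ≤
      energy α₀ α β ε p w := le_self_add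

theorem mul_LEnergy_le_energy (w : L2 Ω Plane × (Fin N → W12 Ω)) (i : Fin N) :
    ENNReal.ofReal (β i) * LEnergy ε (w.2 i) ≤ energy α₀ α β ε p w :=
  (Finset.single_le_sum (f := fun i => ENNReal.ofReal (β i) * LEnergy ε (w.2 i))
    (fun _ _ => zero_le) (Finset.mem_univ i)).trans le_add_self

theorem exists_norm_fst_le [Nonempty (Fin N)] (hα : ∀ i, 0 < α i) (hβ : ∀ i, 0 < β i)
    (hε : 0 < ε) {E : ℝ≥0∞} (hE : E ≠ ⊤) : ∃ C : ℝ, ∀ w : L2 Ω Plane × (Fin N → W12 Ω),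
      energy α₀ α β ε p w ≤ E → ‖w.1‖ ^ 2 ≤ C := by
  obtain ⟨c, hc, hcg⟩ := exists_pos_le_gam (Ω := Ω) hα hβ hε
  have hc' : 0 < c / ε := by positivity
  set k := min (c / ε / 2) (ε ^ p)
  have hk : 0 < k := lt_min (by positivity) (by positivity)
  refine ⟨E.toReal / k, fun w hw => ?_⟩
  have h1 : ENNReal.ofReal (k * ‖w.1‖ ^ 2) ≤ E := by
    rw [norm_sq_eq_integral, ← integral_const_mul, ofReal_integral_eq_lintegral_ofReal
      ((integrable_norm_sq _).const_mul _) (.of_forall fun x => by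
        simp only [Pi.zero_apply]; positivity)]
    refine le_trans (lintegral_mono fun x => ENNReal.ofReal_le_ofReal ?_)
      ((lintegral_omega_le_energy w).trans hw)
    exact mul_sq_le_omega hc' (by gcongr; exact hcg _ _)
  rw [le_div_iff₀ hk, mul_comm]
  exact (ENNReal.ofReal_le_iff_le_toReal hE).1 h1

variable [IsFiniteMeasure ((volume : Measure Plane).restrict Ω)]

theorem exists_norm_subOne_le (hβ : ∀ i, 0 < β i) (hε : 0 < ε) {E : ℝ≥0∞} (hE : E ≠ ⊤)
    (i : Fin N) : ∃ C : ℝ, ∀ w : L2 Ω Plane × (Fin N → W12 Ω),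
      energy α₀ α β ε p w ≤ E → ‖(w.2 i).subOne‖ ^ 2 ≤ C := by
  have hβi := hβ i
  set k := β i * min ε ε⁻¹ / 2
  have hk : 0 < k := by
    have : 0 < min ε ε⁻¹ := lt_min hε (by positivity)
    positivity
  refine ⟨E.toReal / k, fun w hw => ?_⟩
  have h1 := (mul_LEnergy_le_energy w i).trans hw
  rw [LEnergy_eq hε, ← ENNReal.ofReal_mul hβi.le, ENNReal.ofReal_le_iff_le_toReal hE] at h1
  rw [le_div_iff₀ hk, mul_comm]
  refine le_trans ?_ h1
  rw [WithLp.prod_norm_sq_eq_of_L2]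
  calc k * (‖(w.2 i).subOne.fst‖ ^ 2 + ‖(w.2 i).subOne.snd‖ ^ 2)
      = β i * ((min ε ε⁻¹ * ‖(w.2 i).subOne.snd‖ ^ 2 +
          min ε ε⁻¹ * ‖(w.2 i).subOne.fst‖ ^ 2) / 2) := by
        ring
    _ ≤ β i * ((ε * ‖(w.2 i).subOne.snd‖ ^ 2 + ε⁻¹ * ‖(w.2 i).subOne.fst‖ ^ 2) / 2) := by
        gcongr
        · exact min_le_left _ _
        · exact min_le_right _ _
    _ = _ := by rw [inv_mul_eq_div]

/-- Sequences of bounded energy have a subsequence along which `σ` and the jets converge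
weakly. -/
theorem exists_weakTendsto_of_energy_le [Nonempty (Fin N)] (hα : ∀ i, 0 < α i)
    (hβ : ∀ i, 0 < β i) (hε : 0 < ε) {E : ℝ≥0∞} (hE : E ≠ ⊤)
    {w : ℕ → L2 Ω Plane × (Fin N → W12 Ω)} (hw : ∀ n, energy α₀ α β ε p (w n) ≤ E) :
    ∃ (τ : L2 Ω Plane) (x : Fin N → Jet Ω) (φ : ℕ → ℕ), StrictMono φ ∧
      WeakTendsto (fun n => (w (φ n)).1) τ ∧
      ∀ i, WeakTendsto (fun n => ((w (φ n)).2 i).subOne) (x i) := by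
  obtain ⟨C, hC⟩ := exists_norm_fst_le (Ω := Ω) (α₀ := α₀) (p := p) hα hβ hε hE
  choose D hD using
    fun i => exists_norm_subOne_le (Ω := Ω) (α₀ := α₀) (α := α) (p := p) hβ hε hE i
  -- Packing all components into one Hilbert space yields a single subsequence for all of them.
  let z : ℕ → WithLp 2 (L2 Ω Plane × PiLp 2 fun _ : Fin N => Jet Ω) := fun n =>
    WithLp.toLp 2 ((w n).1, WithLp.toLp 2 fun i => ((w n).2 i).subOne)
  have hz : ∀ n, ‖z n‖ ≤ √(C + ∑ i, D i) := by
    intro n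
    refine Real.le_sqrt_of_sq_le ?_
    rw [WithLp.prod_norm_sq_eq_of_L2, PiLp.norm_sq_eq_of_L2]
    exact add_le_add (hC _ (hw n)) (Finset.sum_le_sum fun i _ => hD i _ (hw n))
  have : Fact ((2 : ℝ≥0∞) ≠ ⊤) := ⟨by norm_num⟩
  have : SecondCountableTopology (L2 Ω ℝ) := inferInstance
  have : SecondCountableTopology (L2 Ω Plane) := inferInstance
  have : SecondCountableTopology (Jet Ω) := WithLp.secondCountableTopology 2 _ _
  have : SecondCountableTopology (PiLp 2 fun _ : Fin N => Jet Ω) :=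
    PiLp.secondCountableTopology 2 _
  have : SecondCountableTopology (WithLp 2 (L2 Ω Plane × PiLp 2 fun _ : Fin N => Jet Ω)) :=
    WithLp.secondCountableTopology 2 _ _
  obtain ⟨u, φ, hφ, hu⟩ := exists_weakTendsto_subseq hz
  exact ⟨u.fst, fun i => u.snd i, φ, hφ, hu.fst, fun i => hu.snd.apply i⟩

/-- Weak convergence in `1 + W₀^{1,2}(Ω)` gives a subsequence converging almost everywhere. -/
theorem exists_subseq_val_tendsto_ae (hΩ : IsOpen Ω) (hΩb : Bornology.IsBounded Ω)
    {u : ℕ → Fin N → W12 Ω} {v : Fin N → W12 Ω} (hu : ∀ n i, (u n i).EqOneOnBoundary)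
    (hv : ∀ i, (v i).EqOneOnBoundary) {C : ℝ} (hC : ∀ n i, ‖(u n i).subOne‖ ^ 2 ≤ C)
    (hw : ∀ i, WeakTendsto (fun n => (u n i).subOne) (v i).subOne) :
    ∃ φ : ℕ → ℕ, StrictMono φ ∧ ∀ᵐ x ∂volume.restrict Ω,
      ∀ i, Tendsto (fun n => (u (φ n) i).val x) atTop (𝓝 ((v i).val x)) := by
  have hL1 : ∀ i, Tendsto (fun n => ∫⁻ x in Ω, ‖((u n i).subOne - (v i).subOne).fst x‖ₑ) atTop
      (𝓝 0) := by
    intro i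
    refine tendsto_lintegral_enorm_fst_of_weakTendsto hΩ hΩb
      (x := fun n => (u n i).subOne - (v i).subOne) (C := √C + ‖(v i).subOne‖) (fun n => ?_)
      (fun n => ?_) ?_
    · exact sub_mem ((W12.eqOneOnBoundary_iff _).1 (hu n i)) ((W12.eqOneOnBoundary_iff _).1 (hv i))
    · refine (norm_sub_le _ _).trans ?_
      gcongr
      exact Real.le_sqrt_of_sq_le (hC n i)
    · simpa using (hw i).sub (weakTendsto_of_tendsto (tendsto_const_nhds (x := (v i).subOne)))
  obtain ⟨φ, hφ, hae⟩ := exists_subseq_forall_tendsto_ae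
    (f := fun n i => ((u n i).subOne - (v i).subOne).fst)
    (fun n i => (Lp.stronglyMeasurable _).measurable) hL1
  refine ⟨φ, hφ, ?_⟩
  have hdiff : ∀ᵐ x ∂volume.restrict Ω, ∀ n i,
      ((u n i).subOne - (v i).subOne).fst x = (u n i).val x - (v i).val x := by
    refine ae_all_iff.2 fun n => ae_all_iff.2 fun i => ?_
    filter_upwards [Lp.coeFn_sub (u n i).subOne.fst (v i).subOne.fst, (u n i).coeFn_subOne_fst,
      (v i).coeFn_subOne_fst] with x h1 h2 h3
    rw [WithLp.sub_fst, h1, Pi.sub_apply, h2, h3]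
    ring
  filter_upwards [hae, hdiff] with x h1 h2 i
  have := (h1 i).add_const ((v i).val x)
  simpa only [h2, sub_add_cancel, zero_add] using this

theorem energy_le_liminf [Nonempty (Fin N)] (hα : ∀ i, 0 < α i) (hβ : ∀ i, 0 < β i)
    (hε : 0 < ε) {w : ℕ → L2 Ω Plane × (Fin N → W12 Ω)} {v : L2 Ω Plane × (Fin N → W12 Ω)}
    (hσ : WeakTendsto (fun n => (w n).1) v.1)
    (hφ : ∀ i, WeakTendsto (fun n => ((w n).2 i).subOne) (v.2 i).subOne)
    (hae : ∀ᵐ x ∂volume.restrict Ω,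
      ∀ i, Tendsto (fun n => ((w n).2 i).val x) atTop (𝓝 ((v.2 i).val x))) :
    energy α₀ α β ε p v ≤ liminf (fun n => energy α₀ α β ε p (w n)) atTop := by
  obtain ⟨c, hc, hcg⟩ := exists_pos_le_gam (Ω := Ω) hα hβ hε
  have hc' : 0 < c / ε := by positivity
  have h1 : ∫⁻ x in Ω, ENNReal.ofReal (omega ε p α₀ (gam α β ε v.2 x / ε) ‖v.1 x‖) ≤
      liminf (fun n => ∫⁻ x in Ω,
        ENNReal.ofReal (omega ε p α₀ (gam α β ε (w n).2 x / ε) ‖(w n).1 x‖)) atTop := by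
    refine lintegral_omega_le_liminf hε (g := fun n x => gam α β ε (w n).2 x / ε)
      (g' := fun x => gam α β ε v.2 x / ε) hc' (fun n => (measurable_gam _).div_const _)
      ((measurable_gam _).div_const _) (fun n x => by gcongr; exact hcg _ _)
      (fun x => by gcongr; exact hcg _ _) ?_ hσ
    filter_upwards [hae] with x hx
    exact (tendsto_gam hx).div_const _
  have h2 : ∀ i, ENNReal.ofReal (β i) * LEnergy ε (v.2 i) ≤
      liminf (fun n => ENNReal.ofReal (β i) * LEnergy ε ((w n).2 i)) atTop := fun i => by
    rw [ENNReal.liminf_const_mul_of_ne_top ENNReal.ofReal_ne_top]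
    gcongr
    exact LEnergy_le_liminf hε (hφ i)
  -- The index `none` stands for the coupling term, `some i` for the phase field terms.
  have key := sum_liminf_le_liminf_sum fun n (o : Option (Fin N)) => o.elim
    (∫⁻ x in Ω, ENNReal.ofReal (omega ε p α₀ (gam α β ε (w n).2 x / ε) ‖(w n).1 x‖))
    fun i => ENNReal.ofReal (β i) * LEnergy ε ((w n).2 i)
  simp only [Fintype.sum_option, Option.elim_none, Option.elim_some] at key
  exact (add_le_add h1 (Finset.sum_le_sum fun i _ => h2 i)).trans key

theorem exists_isMinOn_energy [Nonempty (Fin N)] (hΩ : IsOpen Ω) (hΩb : Bornology.IsBounded Ω)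
    (hα : ∀ i, 0 < α i) (hβ : ∀ i, 0 < β i) (hε : 0 < ε) {ρ : Plane → ℝ} {μp μm : Measure Plane}
    {w₀ : L2 Ω Plane × (Fin N → W12 Ω)} (hw₀ : w₀ ∈ admissibleSet Ω N ρ ε μp μm)
    (hfin : energy α₀ α β ε p w₀ < ⊤) :
    ∃ w ∈ admissibleSet Ω N ρ ε μp μm, energy α₀ α β ε p w < ⊤ ∧
      IsMinOn (energy α₀ α β ε p) (admissibleSet Ω N ρ ε μp μm) w := by
  set E := energy (Ω := Ω) α₀ α β ε p
  -- Restricting to the sublevel of `w₀` makes every minimizing sequence bounded; competitors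
  -- outside it are compared with `w₀` at the end.
  set S := {w ∈ admissibleSet Ω N ρ ε μp μm | E w ≤ E w₀}
  obtain ⟨e, -, hlim, he⟩ :=
    exists_seq_tendsto_sInf (S := E '' S) ⟨_, w₀, ⟨hw₀, le_rfl⟩, rfl⟩ (OrderBot.bddBelow _)
  choose w hwS hwe using he
  obtain ⟨τ, x, φ, hφ, hτ, hx⟩ := exists_weakTendsto_of_energy_le (Ω := Ω) hα hβ hε hfin.ne
    (w := w) fun n => (hwS n).2
  choose v hv hvx using fun i =>
    W12.exists_of_weakTendsto (fun n => (hwS (φ n)).1.2 i) (hx i)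
  simp only [← hvx] at hx
  choose D hD using
    fun i => exists_norm_subOne_le (Ω := Ω) (α₀ := α₀) (α := α) (p := p) hβ hε hfin.ne i
  obtain ⟨D', hD'⟩ := (Set.finite_range D).bddAbove
  obtain ⟨χ, hχ, hae⟩ := exists_subseq_val_tendsto_ae hΩ hΩb (u := fun n => (w (φ n)).2) (v := v)
    (fun n i => (hwS (φ n)).1.2 i) hv
    (fun n i => (hD i _ (hwS (φ n)).2).trans (hD' (Set.mem_range_self i))) hx
  have hle : E (τ, v) ≤ sInf (E '' S) := by
    have h1 := energy_le_liminf (α₀ := α₀) (p := p) (v := (τ, v)) hα hβ hε (hτ.comp hχ)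
      (fun i => (hx i).comp hχ) hae
    refine h1.trans_eq (Tendsto.liminf_eq ?_)
    refine (hlim.comp (hφ.tendsto_atTop.comp hχ.tendsto_atTop)).congr fun n => ?_
    exact (hwe _).symm
  have hle₀ : E (τ, v) ≤ E w₀ := hle.trans (sInf_le ⟨w₀, ⟨hw₀, le_rfl⟩, rfl⟩)
  refine ⟨(τ, v), ⟨HasWeakDivergence.of_weakTendsto (fun n => (hwS (φ n)).1.1) hτ, hv⟩,
    hle₀.trans_lt hfin, fun w' hw' => ?_⟩
  rcases le_total (E w') (E w₀) with h | h
  · exact hle.trans (sInf_le ⟨w', ⟨hw', h⟩, rfl⟩)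
  · exact hle₀.trans h

/-- With all phase fields equal to one, the weight is bounded by a constant, so the coupling term is
at most a multiple of `‖σ‖²`. -/
theorem energy_one_lt_top [Nonempty (Fin N)] (hα : ∀ i, 0 < α i) (hβ : ∀ i, 0 < β i)
    (hε : 0 < ε) (σ : L2 Ω Plane) : energy α₀ α β ε p (σ, fun _ => W12.one Ω) < ⊤ := by
  obtain ⟨c, hc, hcg⟩ := exists_pos_le_gam (Ω := Ω) hα hβ hε
  obtain ⟨j⟩ := ‹Nonempty (Fin N)›
  set G := (1 ^ 2 + α j ^ 2 * ε ^ 2 / β j) / ε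
  refine ENNReal.add_lt_top.2 ⟨?_, ?_⟩
  · calc _ ≤ ∫⁻ x in Ω, ENNReal.ofReal ((G + ε ^ p) * ‖σ x‖ ^ 2) := by
          refine lintegral_mono_ae ?_
          filter_upwards [coeFn_oneL2 Ω] with x hx
          refine ENNReal.ofReal_le_ofReal
            ((omega_le hε (div_pos (hc.trans_le (hcg _ x)) hε)).trans ?_)
          have hle : gam α β ε (fun _ => W12.one Ω) x ≤ 1 ^ 2 + α j ^ 2 * ε ^ 2 / β j := by
            have h := ciInf_le (Set.finite_range fun i =>
              (W12.one Ω).val x ^ 2 + α i ^ 2 * ε ^ 2 / β i).bddBelow j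
            simpa only [gam, show (W12.one Ω).val x = 1 from hx] using h
          gcongr
          exact div_le_div_of_nonneg_right hle hε.le
      _ < ⊤ := ((integrable_norm_sq σ).const_mul _).lintegral_lt_top
  · refine ENNReal.sum_lt_top.2 fun i _ => ?_
    rw [LEnergy_eq hε]
    exact ENNReal.mul_lt_top ENNReal.ofReal_lt_top ENNReal.ofReal_lt_top

end direct

end PhaseField

theorem mainTheorem9
    (Ω : Set PhaseField.Plane) (hΩo : IsOpen Ω) (hΩc : IsConnected Ω)
    (hΩb : Bornology.IsBounded Ω) (hΩl : PhaseField.HasLipschitzBoundary Ω)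
    (N : ℕ) (hN : 1 ≤ N) (α₀ : ℝ≥0∞) (α β : Fin N → ℝ)
    (hα₀ : ∀ i, ENNReal.ofReal (α i) < α₀) (hα : StrictAnti α) (hαpos : ∀ i, 0 < α i)
    (hβ : StrictMono β) (hβpos : ∀ i, 0 < β i)
    (μp μm : Measure PhaseField.Plane)
    (hμp : PhaseField.IsAdmissible Ω α₀ μp) (hμm : PhaseField.IsAdmissible Ω α₀ μm)
    (ρ : PhaseField.Plane → ℝ) (hρ : PhaseField.IsKernel ρ)
    (p : ℝ) (hp : 1 < p) (ε : ℝ) (hε : 0 < ε)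
    (hsupp : ∀ x, x ∉ closure Ω →
      PhaseField.smoothed ρ ε μp x = PhaseField.smoothed ρ ε μm x) :
    ∃ w ∈ PhaseField.admissibleSet Ω N ρ ε μp μm,
      PhaseField.energy α₀ α β ε p w < ⊤ ∧
      IsMinOn (PhaseField.energy α₀ α β ε p) (PhaseField.admissibleSet Ω N ρ ε μp μm) w := by
  open PhaseField in
  have : IsFiniteMeasure ((volume : Measure Plane).restrict Ω) :=
    ⟨by simpa using hΩb.measure_lt_top⟩
  have : Nonempty (Fin N) := ⟨⟨0, hN⟩⟩
  have := hμp.isProbabilityMeasure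
  have := hμm.isProbabilityMeasure
  obtain ⟨M, hM⟩ := hρ.exists_bound
  have hcont : Continuous fun x => smoothed ρ ε μp x - smoothed ρ ε μm x :=
    (continuous_smoothed hρ).sub (continuous_smoothed hρ)
  obtain ⟨σ, hσ⟩ := exists_hasWeakDivergence hΩo hΩc.nonempty
    (hΩl.oscillationBound hΩo hΩc.isPreconnected hΩb) hΩb hcont
    (fun x => (norm_sub_le _ _).trans
      (add_le_add (norm_smoothed_le hM x) (norm_smoothed_le hM x)))
    (hΩl.eq_zero_of_notMem hΩo hcont fun x hx => sub_eq_zero.2 (hsupp x hx))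
    (by rw [integral_sub (integrable_smoothed hρ hε) (integrable_smoothed hρ hε),
      integral_smoothed hρ hε, integral_smoothed hρ hε, sub_self])
  exact exists_isMinOn_energy hΩo hΩb hαpos hβpos hε
    (w₀ := (σ, fun _ => W12.one Ω)) ⟨hσ, fun _ => W12.one_eqOneOnBoundary⟩
    (energy_one_lt_top hαpos hβpos hε σ)
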